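/- **Lemma 4.4.** Let $k\ge 2$ and $q$ be integers, $r=kq$, $s>0$, $\alpha\in(0,1)$, $\delta\in(0,1)$, and let $G,c_0,\kappa,M,K$ be constants with $c_0,\kappa>0$. Write $\gamma=\mathcal N(0,I_d)$ and $\sigma(z)=\max\{z,0\}$. There is a constant $C>0$, depending only on $k,q,s,\alpha,\delta,G,c_0,\kappa,M,K$, such that the following holds for every integer $d\ge 2$. Let $g:\mathbb R\to\mathbb R$ be a polynomial of degree at most $q$ whose coefficients are all bounded by $G$ in absolute value and with $\left|\mathbb E_{z\sim\mathcal N(0,1)}[g'(z)]\right|\ge c_0$. Let $p:\mathbb R^d\to\mathbb R$ be a polynomial of degree at most $k$ with $\|p\|_{L^2(\gamma)}=1$, and put $h=g\circ p$. Let $\hat p:\mathbb R^d\to\mathbb R$ be a polynomial of degree at most $k$ with $$\left\|\hat p-\mathbb E_{z\sim\mathcal N(0,1)}[g'(z)]\,p\right\|_{L^2(\gamma)}^2\le K(\log d)^{r/2}d^{-\alpha}.$$ Let $\mu_b$ be a probability density on $\mathbb R$ with $\mu_b(t)\ge\kappa(|t|+1)^{-s}$ for all $t\in\mathbb R$ and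 $\mathbb E_{b\sim\mu_b}[b^8]\le M$. Let $m$ be an integer with $|m-d^\alpha|<1$ (that is, $m=d^\alpha$ up to rounding), and let $a_1,\dots,a_m\sim\mathrm{Unif}\{-1,1\}$ and $b_1,\dots,b_m\sim\mu_b$ all be independent. Then with probability at least $1-\delta/4$ over $(a_i,b_i)_{i\le m}$ there is $c^*\in\mathbb R^m$ with $$\|c^*\|_\infty\le C(\log d)^{k(s+q)}d^{-\alpha}$$ and $$\left\|\hat p+\sum_{i=1}^m c_i^*\,\sigma(a_i\hat p+b_i)-h\right\|_{L^2(\gamma)}^2\le C(\log d)^{r/2+2k(s+q)}d^{-\alpha}.$$ -/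

import Mathlib

open MeasureTheory ProbabilityTheory
open scoped ENNReal

/-- The standard Gaussian distribution `N(0, I_d)` on `ℝ^d`. -/
noncomputable def stdGauss (d : ℕ) : Measure (Fin d → ℝ) :=
  Measure.pi fun _ => gaussianReal 0 1

/-- The ReLU activation. -/
noncomputable def relu (z : ℝ) : ℝ := max z 0

/-- The uniform distribution on `{-1, 1}`. -/
noncomputable def signLaw : Measure ℝ :=
  (2⁻¹ : ℝ≥0∞) • Measure.dirac 1 + (2⁻¹ : ℝ≥0∞) • Measure.dirac (-1)

/-- The distribution on `ℝ` with Lebesgue density `ρ`. -/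
noncomputable def densityLaw (ρ : ℝ → ℝ) : Measure ℝ :=
  volume.withDensity fun t => ENNReal.ofReal (ρ t)

/-- `ρ` is a probability density with the heavy-tail lower bound
`ρ t ≥ κ (|t| + 1)^(-s)` and with eighth moment at most `M`. -/
structure IsHeavyTailedDensity (s κ M : ℝ) (ρ : ℝ → ℝ) : Prop where
  measurable : Measurable ρ
  isProb : IsProbabilityMeasure (densityLaw ρ)
  lower_bound : ∀ t : ℝ, κ * (|t| + 1) ^ (-s) ≤ ρ t
  moment_eight : ∫⁻ t, ENNReal.ofReal (t ^ 8) ∂(densityLaw ρ) ≤ ENNReal.ofReal M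

/-- The joint law of `m` independent pairs `(a_i, b_i)`, where `a_i` is uniform on `{-1, 1}`,
`b_i` has density `ρ`, and `a_i`, `b_i` are independent. -/
noncomputable def featureLaw (m : ℕ) (ρ : ℝ → ℝ) : Measure (Fin m → ℝ × ℝ) :=
  Measure.pi fun _ => signLaw.prod (densityLaw ρ)

/-- The one-dimensional two-layer network with residual link,
`z ↦ z + ∑ i, c_i σ(a_i z + b_i)`, where `w i = (a_i, b_i)`. -/
noncomputable def residualNet {m : ℕ} (w : Fin m → ℝ × ℝ) (c : Fin m → ℝ) (z : ℝ) : ℝ :=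
  z + ∑ i, c i * relu ((w i).1 * z + (w i).2)

/-- `E[g'(z)]` for `z` standard Gaussian. -/
noncomputable def meanDeriv (g : Polynomial ℝ) : ℝ :=
  ∫ z, g.derivative.eval z ∂(gaussianReal 0 1)

/-- The squared `L²(N(0, I_d))` norm, as an extended nonnegative real. -/
noncomputable def gaussNormSq {d : ℕ} (f : (Fin d → ℝ) → ℝ) : ℝ≥0∞ :=
  eLpNorm f 2 (stdGauss d) ^ 2

/-! Write `v` for `meanDeriv g`. Since `phat` is close to `v p` and `|v| ≥ c₀`, the target `g(p)` is
close to `g(v⁻¹ phat)`, a function of `phat` alone. The residual link already supplies `phat`, so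
the ReLU sum only has to imitate the univariate polynomial `F(z) = g(z / v) - z`
(`rescaledResidual`) at `z = phat`. Three errors arise.

Sampling. On `[-R, R]` Taylor's formula makes `F` an exact average of features `W(a, b) relu(a z +
b)`, and the heavy tail of the bias density keeps `|W|` below a constant times `R ^ (s + q - 1)`
(`exists_relu_representation`). The coefficients `W(a_i, b_i) / m` turn this average into an
empirical mean, whose mean squared error is of order `R ^ (2 (s + q)) / m`; Markov's inequality
yields the event (`exists_event_empirical_mean_close`).

Truncation. Hypercontractivity bounds the `2n`-norm of a degree-`k` Gaussian polynomial by `A n ^ k`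
times its `2`-norm, uniformly in the dimension (`exists_gaussian_moment_bound`). With `n` of order
`log d` and `R` of order `n ^ k`, the region `|phat| > R` has tail moment `O(d ^ (-α))`
(`exists_tail_bound`, `truncation_bounds`). The growth `n ^ k` is not the sharp one, but it matches
the power of `log d` in the claim.

Estimation. Composition with `g` is Lipschitz in `L²` on bounded sets of polynomials of degree at
most `k`, again by hypercontractivity (`exists_composition_lipschitz`), so replacing `p` by `v⁻¹
phat` costs a constant times the assumed squared error. -/

/-! ### One-dimensional Gaussian integrals of polynomials -/

theorem integrable_pow_gaussianReal (n : ℕ) :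
    Integrable (fun x : ℝ => x ^ n) (gaussianReal 0 1) := by
  have h := (memLp_id_gaussianReal (μ := 0) (v := 1) n).integrable_norm_pow'
  refine h.mono' (by fun_prop) (ae_of_all _ fun x => ?_)
  simp

theorem integrable_polynomial_gaussianReal (P : Polynomial ℝ) :
    Integrable (fun x => P.eval x) (gaussianReal 0 1) := by
  simp_rw [Polynomial.eval_eq_sum_range]
  exact integrable_finsetSum _ fun i _ => (integrable_pow_gaussianReal i).const_mul _

theorem hasDerivAt_gaussianPDFReal_std (x : ℝ) :
    HasDerivAt (gaussianPDFReal 0 1) (-x * gaussianPDFReal 0 1 x) x := by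
  have h1 : HasDerivAt (fun y : ℝ => -(y - 0) ^ 2 / (2 * ((1 : NNReal) : ℝ))) (-x) x := by
    refine (((((hasDerivAt_id x).sub_const 0).pow 2).neg).div_const
      (2 * ((1 : NNReal) : ℝ))).congr_deriv ?_
    norm_num
    ring
  have h2 := (h1.exp).const_mul ((√(2 * Real.pi * ((1 : NNReal) : ℝ)))⁻¹)
  rw [gaussianPDFReal_def]
  refine h2.congr_deriv ?_
  ring

theorem integrable_gaussianPDFReal_mul {f : ℝ → ℝ} (hf : Integrable f (gaussianReal 0 1)) :
    Integrable (fun x => gaussianPDFReal 0 1 x * f x) := by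
  rw [gaussianReal_of_var_ne_zero _ one_ne_zero,
    integrable_withDensity_iff_integrable_smul' (measurable_gaussianPDF 0 1)
      (ae_of_all _ fun _ => gaussianPDF_lt_top)] at hf
  simpa [toReal_gaussianPDF] using hf

/-- Gaussian integration by parts: the derivative of density times `P` is integrable and integrates
to zero. -/
theorem integral_mul_polynomial_gaussianReal (P : Polynomial ℝ) :
    ∫ x, x * P.eval x ∂(gaussianReal 0 1) = ∫ x, P.derivative.eval x ∂(gaussianReal 0 1) := by
  have hd : ∀ x, HasDerivAt (fun x => gaussianPDFReal 0 1 x * P.eval x)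
      (gaussianPDFReal 0 1 x * P.derivative.eval x - gaussianPDFReal 0 1 x * (x * P.eval x)) x := by
    intro x
    refine ((hasDerivAt_gaussianPDFReal_std x).mul (P.hasDerivAt x)).congr_deriv ?_
    ring
  have i1 := integrable_gaussianPDFReal_mul (integrable_polynomial_gaussianReal P.derivative)
  have i2 := integrable_gaussianPDFReal_mul (f := fun x => x * P.eval x) 
    ((integrable_polynomial_gaussianReal (Polynomial.X * P)).congr
      (ae_of_all _ fun x => by simp))
  have h0 := integral_eq_zero_of_hasDerivAt_of_integrable hd (i1.sub i2)
    (integrable_gaussianPDFReal_mul (integrable_polynomial_gaussianReal P))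
  rw [integral_sub i1 i2] at h0
  rw [integral_gaussianReal_eq_integral_smul one_ne_zero,
    integral_gaussianReal_eq_integral_smul one_ne_zero]
  simp only [smul_eq_mul]
  linarith

/-! ### Normalized Hermite polynomials -/

/-- The probabilists' Hermite polynomial with real coefficients. -/
noncomputable def hermiteReal (n : ℕ) : Polynomial ℝ :=
  (Polynomial.hermite n).map (Int.castRingHom ℝ)

theorem hermiteReal_succ (n : ℕ) :
    hermiteReal (n + 1) = Polynomial.X * hermiteReal n - (hermiteReal n).derivative := by
  simp [hermiteReal, Polynomial.hermite_succ, Polynomial.derivative_map]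

theorem hermiteReal_monic (n : ℕ) : (hermiteReal n).Monic :=
  (Polynomial.hermite_monic n).map _

theorem natDegree_hermiteReal (n : ℕ) : (hermiteReal n).natDegree = n := by
  rw [hermiteReal, (Polynomial.hermite_monic n).natDegree_map, Polynomial.natDegree_hermite]

/-- Integrating `x H_n P` by parts gives `H_n' P + H_n P'`; the recursion for `H_{n+1}` subtracts
the first term, so each step moves one derivative onto `P`. -/
theorem integral_hermiteReal_mul (n : ℕ) (P : Polynomial ℝ) :
    ∫ x, (hermiteReal n * P).eval x ∂(gaussianReal 0 1) =
      ∫ x, (Polynomial.derivative^[n] P).eval x ∂(gaussianReal 0 1) := by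
  induction n generalizing P with
  | zero => simp [hermiteReal]
  | succ n ih =>
    have h := integral_mul_polynomial_gaussianReal (hermiteReal n * P)
    have e : ∀ x : ℝ, (hermiteReal (n + 1) * P).eval x =
        x * (hermiteReal n * P).eval x - ((hermiteReal n).derivative * P).eval x := by
      intro x
      simp [hermiteReal_succ]
      ring
    have i1 := integrable_polynomial_gaussianReal (Polynomial.X * (hermiteReal n * P))
    simp only [Polynomial.eval_mul (p := Polynomial.X), Polynomial.eval_X] at i1
    simp_rw [e]
    rw [integral_sub i1 (integrable_polynomial_gaussianReal _), h, Polynomial.derivative_mul]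
    simp_rw [Polynomial.eval_add]
    rw [integral_add (integrable_polynomial_gaussianReal _) (integrable_polynomial_gaussianReal _),
      add_sub_cancel_left, ih, Function.iterate_succ_apply]

theorem integral_hermiteReal_mul_hermiteReal (i j : ℕ) :
    ∫ x, (hermiteReal i * hermiteReal j).eval x ∂(gaussianReal 0 1) =
      if i = j then (i.factorial : ℝ) else 0 := by
  -- With `j ≤ i`, the `i` derivatives landing on `H_j` either kill it or leave the constant `i!`.
  wlog hij : j ≤ i generalizing i j
  · rw [mul_comm, this j i (by omega)]
    by_cases h : i = j
    · simp [h]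
    · simp [h, Ne.symm h]
  rw [integral_hermiteReal_mul]
  split_ifs with h
  · subst h
    have hd : (Polynomial.derivative^[i] (hermiteReal i)).natDegree = 0 := by
      have := Polynomial.natDegree_iterate_derivative (hermiteReal i) i
      rw [natDegree_hermiteReal] at this
      omega
    rw [Polynomial.eq_C_of_natDegree_eq_zero hd, Polynomial.coeff_iterate_derivative]
    have hc : (hermiteReal i).coeff i = 1 := by
      conv_lhs => rw [← natDegree_hermiteReal i]
      simpa [natDegree_hermiteReal] using (hermiteReal_monic i).coeff_natDegree
    simp [hc, Nat.descFactorial_self]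
  · rw [Polynomial.iterate_derivative_eq_zero (by rw [natDegree_hermiteReal]; omega)]
    simp

/-- The `n`-th Hermite polynomial normalized in `L²(N(0,1))`. -/
noncomputable def hermiteNormalized (n : ℕ) : Polynomial ℝ :=
  Polynomial.C (√(n.factorial : ℝ))⁻¹ * hermiteReal n

theorem integral_hermiteNormalized_mul (i j : ℕ) :
    ∫ x, (hermiteNormalized i).eval x * (hermiteNormalized j).eval x ∂(gaussianReal 0 1) =
      if i = j then (1 : ℝ) else 0 := by
  have e : ∀ x : ℝ, (hermiteNormalized i).eval x * (hermiteNormalized j).eval x =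
      ((√(i.factorial : ℝ))⁻¹ * (√(j.factorial : ℝ))⁻¹) *
        (hermiteReal i * hermiteReal j).eval x := by
    intro x
    simp [hermiteNormalized]
    ring
  simp_rw [e]
  rw [integral_const_mul, integral_hermiteReal_mul_hermiteReal]
  split_ifs with h
  · subst h
    have : (0 : ℝ) < i.factorial := by positivity
    rw [← mul_inv, Real.mul_self_sqrt this.le, inv_mul_cancel₀ this.ne']
  · simp

theorem hermiteNormalized_zero : hermiteNormalized 0 = 1 := by
  simp [hermiteNormalized, hermiteReal]

theorem natDegree_hermiteNormalized (n : ℕ) : (hermiteNormalized n).natDegree = n := by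
  rw [hermiteNormalized, Polynomial.natDegree_C_mul (by positivity), natDegree_hermiteReal]

theorem integral_hermiteNormalized {j : ℕ} (hj : j ≠ 0) :
    ∫ x, (hermiteNormalized j).eval x ∂(gaussianReal 0 1) = 0 := by
  simpa [hermiteNormalized_zero, hj] using integral_hermiteNormalized_mul j 0

/-- Powers are combinations of normalized Hermite polynomials of at most the same degree. -/
theorem exists_pow_eq_sum_hermiteNormalized (a : ℕ) :
    ∃ t : ℕ → ℝ, (∀ j, a < j → t j = 0) ∧
      ∀ x : ℝ, x ^ a = ∑ j ∈ Finset.range (a + 1), t j * (hermiteNormalized j).eval x := by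
  have key : ∀ n : ℕ, ∀ P : Polynomial ℝ, P.natDegree < n →
      ∃ t : ℕ → ℝ, ∀ x : ℝ, P.eval x = ∑ j ∈ Finset.range n, t j * (hermiteNormalized j).eval x := by
    intro n
    induction n with
    | zero => intro P hP; omega
    | succ n ih =>
      intro P hP
      -- Removing the leading term lowers `natDegree` strictly only when `n > 0`, so constants are
      -- treated apart.
      by_cases hn : n = 0
      · subst hn
        refine ⟨fun _ => P.coeff 0, fun x => ?_⟩
        rw [Polynomial.eq_C_of_natDegree_eq_zero (p := P) (by omega)]
        simp [hermiteNormalized_zero]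
      set u : ℝ := P.coeff n * √(n.factorial : ℝ) with hu
      have hlead : (hermiteNormalized n).coeff n = (√(n.factorial : ℝ))⁻¹ := by
        have hc : (hermiteReal n).coeff n = 1 := by
          have := (hermiteReal_monic n).coeff_natDegree
          rwa [natDegree_hermiteReal] at this
        simp [hermiteNormalized, hc]
      have hs : √(n.factorial : ℝ) ≠ 0 := by positivity
      have hQ : (P - Polynomial.C u * hermiteNormalized n).natDegree < n := by
        have hle : (P - Polynomial.C u * hermiteNormalized n).natDegree ≤ n := by
          refine (Polynomial.natDegree_sub_le _ _).trans (max_le (by omega) ?_)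
          exact (Polynomial.natDegree_C_mul_le _ _).trans (natDegree_hermiteNormalized n).le
        have hc : (P - Polynomial.C u * hermiteNormalized n).coeff n = 0 := by
          simp [hlead, hu, mul_assoc, hs]
        refine lt_of_le_of_ne hle fun h => ?_
        have h0 := Polynomial.coeff_natDegree (p := P - Polynomial.C u * hermiteNormalized n)
        rw [h, hc, eq_comm, Polynomial.leadingCoeff_eq_zero] at h0
        rw [h0] at h
        simp at h
        exact hn h.symm
      obtain ⟨t, ht⟩ := ih _ hQ
      refine ⟨fun j => if j = n then u else t j, fun x => ?_⟩
      rw [Finset.sum_range_succ]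
      simp only [if_true]
      have := ht x
      simp only [Polynomial.eval_sub, Polynomial.eval_mul, Polynomial.eval_C] at this
      rw [sub_eq_iff_eq_add] at this
      rw [this]
      congr 1
      refine Finset.sum_congr rfl fun j hj => ?_
      simp only [(Finset.mem_range.1 hj).ne, if_false]
  obtain ⟨t, ht⟩ := key (a + 1) (Polynomial.X ^ a) (by simp)
  refine ⟨fun j => if a < j then 0 else t j, fun j hj => by simp [hj], fun x => ?_⟩
  have := ht x
  rw [Polynomial.eval_pow, Polynomial.eval_X] at this
  rw [this]
  refine Finset.sum_congr rfl fun j hj => ?_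
  simp only [show ¬a < j by have := Finset.mem_range.1 hj; omega, if_false]

/-! ### Hypercontractivity for Gaussian polynomials -/

/-- The linear term is kept apart because it integrates to zero for centred `g`; everything else
fits into an `n`-th power. For `|g| ≤ 1/(2n)` this is a second-order expansion of the exponential;
for larger `|g|` the linear term is dominated by `n g ^ 2`. -/
theorem one_add_pow_two_mul_le {n : ℕ} (hn : 1 ≤ n) (g : ℝ) :
    (1 + g) ^ (2 * n) ≤ 2 * n * g + (1 + 9 * n * g ^ 2) ^ n := by
  have hn' : (1 : ℝ) ≤ n := by exact_mod_cast hn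
  have bern : ∀ x : ℝ, 0 ≤ x → 1 + n * x ≤ (1 + x) ^ n := fun x hx =>
    one_add_mul_le_pow (by linarith) n
  rcases le_or_gt (2 * n * |g|) 1 with h | h
  · have hg : |2 * n * g| ≤ 1 := by
      rw [abs_mul, abs_of_nonneg (by positivity : (0 : ℝ) ≤ 2 * n)]
      exact h
    have h1 : (1 + g) ^ (2 * n) ≤ Real.exp (2 * n * g) := by
      have hpos : 0 ≤ 1 + g := by
        have : |g| ≤ 1 := by nlinarith [abs_nonneg g]
        linarith [neg_abs_le g]
      calc (1 + g) ^ (2 * n) ≤ (Real.exp g) ^ (2 * n) :=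
            pow_le_pow_left₀ hpos (by linarith [Real.add_one_le_exp g]) _
        _ = Real.exp (2 * n * g) := by rw [← Real.exp_nat_mul]; push_cast; ring_nf
    have h2 : Real.exp (2 * n * g) ≤ 1 + 2 * n * g + (2 * n * g) ^ 2 := by
      have := Real.abs_exp_sub_one_sub_id_le hg
      linarith [le_abs_self (Real.exp (2 * n * g) - 1 - 2 * n * g)]
    have h3 := bern (9 * n * g ^ 2) (by positivity)
    nlinarith [sq_nonneg (n * g)]
  · have hg2 : 2 * |g| ≤ 4 * n * g ^ 2 := by
      rw [← sq_abs]
      nlinarith [abs_nonneg g]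
    have h1 : (1 + g) ^ (2 * n) ≤ (1 + (4 * n + 1) * g ^ 2) ^ n := by
      rw [pow_mul]
      refine pow_le_pow_left₀ (sq_nonneg _) ?_ n
      nlinarith [le_abs_self g]
    -- The extra room `n * (4 n g ^ 2)` pays for a negative linear term `2 n g`. Since `(4n + 1) +
    -- 4n ≤ 9n`, the constant 9 suffices.
    have h2 : (1 + (4 * n + 1) * g ^ 2) ^ n + n * (4 * n * g ^ 2) ≤ (1 + 9 * n * g ^ 2) ^ n := by
      set u := 1 + (4 * n + 1) * g ^ 2 with hu
      set y := 4 * n * g ^ 2 with hy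
      have hu1 : 1 ≤ u := by rw [hu]; nlinarith [sq_nonneg g]
      have hy0 : 0 ≤ y := by positivity
      have hu0 : 0 < u := by linarith
      have hun : 1 ≤ u ^ n / u := by
        rw [one_le_div hu0]
        exact le_self_pow₀ hu1 (by omega)
      calc u ^ n + n * y ≤ u ^ n + n * y * (u ^ n / u) := by
            nlinarith [mul_nonneg (by positivity : (0 : ℝ) ≤ n) hy0]
        _ = u ^ n * (1 + n * (y / u)) := by ring
        _ ≤ u ^ n * (1 + y / u) ^ n := by gcongr; exact bern _ (by positivity)
        _ = (u + y) ^ n := by rw [← mul_pow]; congr 1; field_simp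
        _ ≤ _ := by
            refine pow_le_pow_left₀ (by positivity) ?_ n
            rw [hu, hy]
            nlinarith [sq_nonneg g]
    nlinarith [neg_abs_le g]

theorem add_pow_two_mul_le {n : ℕ} (hn : 1 ≤ n) (a g : ℝ) :
    (a + g) ^ (2 * n) ≤ 2 * n * a ^ (2 * n - 1) * g + (a ^ 2 + 9 * n * g ^ 2) ^ n := by
  have hn' : (1 : ℝ) ≤ n := by exact_mod_cast hn
  by_cases ha : a = 0
  · subst ha
    rw [zero_pow (by omega : 2 * n - 1 ≠ 0), pow_mul]
    simp only [zero_add, mul_zero, zero_mul, ne_eq, OfNat.ofNat_ne_zero, not_false_eq_true,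
      zero_pow]
    refine pow_le_pow_left₀ (sq_nonneg _) ?_ n
    nlinarith [sq_nonneg g]
  · have h := mul_le_mul_of_nonneg_left (one_add_pow_two_mul_le hn (g / a))
      (by rw [pow_mul]; positivity : 0 ≤ a ^ (2 * n))
    rw [← mul_pow, mul_add, mul_add, mul_one, mul_div_cancel₀ _ ha] at h
    refine h.trans (le_of_eq ?_)
    congr 1
    · rw [show a ^ (2 * n) = a ^ (2 * n - 1) * a by rw [← pow_succ]; congr 1; omega]
      field_simp
    · rw [pow_mul, ← mul_pow]
      congr 1
      field_simp

/-- Jensen's inequality for the power function at the points `1` and `w`, with weights proportional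
to `s` and `t`. -/
theorem add_mul_pow_le {n : ℕ} {s t w : ℝ} (hs : 0 ≤ s) (ht : 0 ≤ t) (hw : 0 ≤ w) :
    (s + t * w) ^ (n + 1) ≤ (s + t) ^ n * (s + t * w ^ (n + 1)) := by
  rcases (add_nonneg hs ht).eq_or_lt with h | h
  · have hs0 : s = 0 := by linarith
    have ht0 : t = 0 := by linarith
    simp [hs0, ht0]
  have hc := (convexOn_pow (𝕜 := ℝ) (n + 1)).2 (Set.mem_Ici.2 zero_le_one) (Set.mem_Ici.2 hw)
    (by positivity : 0 ≤ s / (s + t)) (by positivity : 0 ≤ t / (s + t)) (by field_simp)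
  simp only [smul_eq_mul, one_pow, mul_one] at hc
  have h2 := mul_le_mul_of_nonneg_left hc (by positivity : 0 ≤ (s + t) ^ (n + 1))
  rw [← mul_pow] at h2
  have e1 : (s + t) * (s / (s + t) + t / (s + t) * w) = s + t * w := by field_simp
  have e2 : (s + t) ^ (n + 1) * (s / (s + t) + t / (s + t) * w ^ (n + 1)) =
      (s + t) ^ n * (s + t * w ^ (n + 1)) := by rw [pow_succ]; field_simp
  rwa [e1, e2] at h2

theorem Polynomial.sq_eval_le (P : Polynomial ℝ) :
    ∃ A : ℝ, 0 ≤ A ∧ ∀ y : ℝ, P.eval y ^ 2 ≤ A * (1 + y ^ 2) ^ P.natDegree := by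
  refine ⟨(∑ i ∈ Finset.range (P.natDegree + 1), |P.coeff i|) ^ 2, sq_nonneg _, fun y => ?_⟩
  have h1 : 1 ≤ √(1 + y ^ 2) := by rw [Real.one_le_sqrt]; nlinarith [sq_nonneg y]
  have hy : |y| ≤ √(1 + y ^ 2) := Real.abs_le_sqrt (by linarith)
  have h2 : |P.eval y| ≤
      (∑ i ∈ Finset.range (P.natDegree + 1), |P.coeff i|) * √(1 + y ^ 2) ^ P.natDegree := by
    rw [Polynomial.eval_eq_sum_range, Finset.sum_mul]
    refine (Finset.abs_sum_le_sum_abs _ _).trans (Finset.sum_le_sum fun i hi => ?_)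
    rw [abs_mul, abs_pow]
    refine mul_le_mul_of_nonneg_left ?_ (abs_nonneg _)
    exact (pow_le_pow_left₀ (abs_nonneg _) hy i).trans
      (pow_le_pow_right₀ h1 (by have := Finset.mem_range.1 hi; omega))
  calc P.eval y ^ 2 = |P.eval y| ^ 2 := (sq_abs _).symm
    _ ≤ _ := pow_le_pow_left₀ (abs_nonneg _) h2 2
    _ = _ := by
      rw [mul_pow, ← pow_mul, mul_comm P.natDegree 2, pow_mul, Real.sq_sqrt (by positivity)]

/-- The exponent `1/4` stays below the `1/2` of the Gaussian density. -/
theorem integrable_exp_quarter_gaussianReal :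
    Integrable (fun y : ℝ => Real.exp ((1 + y ^ 2) / 4)) (gaussianReal 0 1) := by
  rw [gaussianReal_of_var_ne_zero _ one_ne_zero,
    integrable_withDensity_iff_integrable_smul' (measurable_gaussianPDF 0 1)
      (ae_of_all _ fun _ => gaussianPDF_lt_top)]
  have h := (integrable_exp_neg_mul_sq (b := 1 / 4) (by norm_num)).const_mul
    ((√(2 * Real.pi))⁻¹ * Real.exp (1 / 4))
  refine h.congr (ae_of_all _ fun y => ?_)
  simp only [toReal_gaussianPDF, smul_eq_mul, gaussianPDFReal_def, NNReal.coe_one, mul_one,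
    sub_zero]
  rw [mul_assoc, mul_assoc, ← Real.exp_add, ← Real.exp_add]
  ring_nf

/-- The weights `n * (ε / n) ^ (2 j) * h_j ^ 2` have small `n`-th moments. -/
theorem exists_hermite_weight_bound (k : ℕ) :
    ∃ ε : ℝ, 0 < ε ∧ ε ≤ 1 ∧ ∀ n : ℕ, 1 ≤ n →
      ∫ y, (9 * n * ∑ j : Fin k, ((ε / n) ^ (j.1 + 1) *
        (hermiteNormalized (j.1 + 1)).eval y) ^ 2) ^ n ∂(gaussianReal 0 1) ≤ 1 := by
  choose A hA0 hA using fun j : ℕ => (hermiteNormalized j).sq_eval_le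
  simp_rw [natDegree_hermiteNormalized] at hA
  set D : ℝ := 9 * ∑ j : Fin k, A (j.1 + 1) * (4 ^ (j.1 + 1) * (j.1 + 1).factorial) with hD
  have hD0 : 0 ≤ D := by
    rw [hD]
    refine mul_nonneg (by norm_num) (Finset.sum_nonneg fun j _ => ?_)
    exact mul_nonneg (hA0 _) (by positivity)
  set E : ℝ := ∫ y, Real.exp ((1 + y ^ 2) / 4) ∂(gaussianReal 0 1) with hE
  have hE0 : 0 ≤ E := integral_nonneg fun _ => by positivity
  -- Small enough that `ε ^ 2 * D * (1 + E) ≤ 1`, which closes the estimate for every `n` at once.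
  set ε : ℝ := ((1 + D) * (1 + E))⁻¹ with hε
  have hε0 : 0 < ε := by positivity
  have hε1 : ε ≤ 1 := by
    rw [hε]
    exact inv_le_one_of_one_le₀ (by nlinarith [mul_nonneg hD0 hE0])
  have hεD : ε ^ 2 * D * (1 + E) ≤ 1 := by
    have h1 : ε * ((1 + D) * (1 + E)) = 1 := by rw [hε]; field_simp
    have h2 : ε * (D * (1 + E)) ≤ 1 := by nlinarith
    have h3 : 0 ≤ ε * (D * (1 + E)) := by positivity
    calc ε ^ 2 * D * (1 + E) = ε * (ε * (D * (1 + E))) := by ring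
      _ ≤ 1 * 1 := by gcongr
      _ = 1 := by norm_num
  refine ⟨ε, hε0, hε1, fun n hn => ?_⟩
  have hn' : (1 : ℝ) ≤ n := by exact_mod_cast hn
  -- From `x ^ i ≤ i! exp x` at `x = (1 + y ^ 2) / (4 n)`: the `n`-th power of the bound contains
  -- `exp ((1 + y ^ 2) / 4)`, which no longer depends on `n`.
  have hpt : ∀ y : ℝ, 9 * n * ∑ j : Fin k, ((ε / n) ^ (j.1 + 1) *
      (hermiteNormalized (j.1 + 1)).eval y) ^ 2 ≤
        ε ^ 2 * D * Real.exp ((1 + y ^ 2) / 4 / n) := by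
    intro y
    rw [hD, Finset.mul_sum, Finset.mul_sum, Finset.mul_sum, Finset.sum_mul]
    refine Finset.sum_le_sum fun j _ => ?_
    set i := j.1 + 1 with hi
    have hexp := Real.pow_div_factorial_le_exp ((1 + y ^ 2) / 4 / n) (by positivity) i
    rw [div_le_iff₀ (by positivity)] at hexp
    have hε2 : ε ^ (2 * i) ≤ ε ^ 2 := pow_le_pow_of_le_one hε0.le hε1 (by omega)
    -- Needs `i ≥ 1`; hence the constant Hermite term is left out of the weight.
    have hnn : (n : ℝ) * (1 / n) ^ (2 * i) ≤ (1 / n) ^ i := by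
      have : (n : ℝ) * (1 / n) ^ (2 * i) = (1 / n) ^ (2 * i - 1) := by
        rw [show 2 * i = 2 * i - 1 + 1 by omega, pow_succ]
        simp
        field_simp
      rw [this]
      exact pow_le_pow_of_le_one (by positivity) (by rw [div_le_one (by positivity)]; exact hn')
        (by omega)
    calc 9 * n * ((ε / n) ^ i * (hermiteNormalized i).eval y) ^ 2
        = 9 * (ε ^ (2 * i) * (n * (1 / n) ^ (2 * i)) * (hermiteNormalized i).eval y ^ 2) := by
          rw [div_eq_mul_one_div, mul_pow, mul_pow, mul_pow, ← pow_mul, ← pow_mul, mul_comm i 2]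
          ring
      _ ≤ 9 * (ε ^ 2 * (1 / n) ^ i * (A i * (1 + y ^ 2) ^ i)) := by
          gcongr
          exact hA i y
      _ = 9 * ε ^ 2 * A i * 4 ^ i * ((1 + y ^ 2) / 4 / n) ^ i := by
          rw [div_pow, div_pow, div_pow]
          field_simp
          simp
      _ ≤ 9 * ε ^ 2 * A i * 4 ^ i * (Real.exp ((1 + y ^ 2) / 4 / n) * i.factorial) := by
          have := hA0 i
          gcongr
      _ = _ := by ring
  calc _ ≤ ∫ y, (ε ^ 2 * D) ^ n * Real.exp ((1 + y ^ 2) / 4) ∂(gaussianReal 0 1) := by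
        refine integral_mono_of_nonneg (ae_of_all _ fun y => by positivity)
          (integrable_exp_quarter_gaussianReal.const_mul _) (ae_of_all _ fun y => ?_)
        refine (pow_le_pow_left₀ (by positivity) (hpt y) n).trans (le_of_eq ?_)
        rw [mul_pow, ← Real.exp_nat_mul]
        congr 2
        field_simp
    _ = (ε ^ 2 * D) ^ n * E := by rw [integral_const_mul]
    _ ≤ (ε ^ 2 * D) * (1 + E) := by
        have h0 : 0 ≤ ε ^ 2 * D := by positivity
        have h1 : ε ^ 2 * D ≤ 1 := by nlinarith
        gcongr
        · exact pow_le_of_le_one h0 h1 (by omega)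
        · linarith
    _ ≤ 1 := hεD

/-- Split the sum as `a 0 + g` with `g` centred. The elementary inequality for `(a + g) ^ (2n)`
loses its linear term on integration, Cauchy–Schwarz replaces `9 n g ^ 2` by `b * W` with `W`
independent of the coefficients, and Jensen reduces everything to `∫ W ^ n ≤ 1`. -/
theorem exists_hypercontractive_one_dim (k : ℕ) :
    ∃ ε : ℝ, 0 < ε ∧ ε ≤ 1 ∧ ∀ n : ℕ, 1 ≤ n → ∀ a : Fin (k + 1) → ℝ,
      ∫⁻ y, ENNReal.ofReal ((∑ j, a j * ((ε / n) ^ j.1 * (hermiteNormalized j.1).eval y)) ^ (2 * n))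
        ∂(gaussianReal 0 1) ≤ ENNReal.ofReal ((∑ j, a j ^ 2) ^ n) := by
  obtain ⟨ε, hε0, hε1, hW⟩ := exists_hermite_weight_bound k
  refine ⟨ε, hε0, hε1, fun n hn a => ?_⟩
  specialize hW n hn
  have hn' : (1 : ℝ) ≤ n := by exact_mod_cast hn
  set u : Fin k → ℝ → ℝ := fun j y => (ε / n) ^ (j.1 + 1) * (hermiteNormalized (j.1 + 1)).eval y
    with hu
  set W : ℝ → ℝ := fun y => 9 * n * ∑ j, u j y ^ 2 with hWdef
  set g : ℝ → ℝ := fun y => ∑ j : Fin k, a j.succ * u j y with hg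
  set b : ℝ := ∑ j : Fin k, a j.succ ^ 2 with hb
  have hb0 : 0 ≤ b := Finset.sum_nonneg fun _ _ => sq_nonneg _
  have hW0 : ∀ y, 0 ≤ W y := fun y => by
    have : 0 ≤ ∑ j, u j y ^ 2 := Finset.sum_nonneg fun _ _ => sq_nonneg _
    positivity
  have polyu : ∀ j, ∃ P : Polynomial ℝ, ∀ y, u j y = P.eval y := fun j =>
    ⟨Polynomial.C ((ε / n) ^ (j.1 + 1)) * hermiteNormalized (j.1 + 1), fun y => by simp [hu]⟩
  choose U hU using polyu
  have intu : ∀ j, Integrable (u j) (gaussianReal 0 1) := fun j =>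
    (integrable_polynomial_gaussianReal (U j)).congr (ae_of_all _ fun y => (hU j y).symm)
  have intg : Integrable g (gaussianReal 0 1) :=
    integrable_finsetSum _ fun j _ => (intu j).const_mul _
  have g0 : ∫ y, g y ∂(gaussianReal 0 1) = 0 := by
    rw [hg, integral_finsetSum _ fun j _ => (intu j).const_mul _]
    refine Finset.sum_eq_zero fun j _ => ?_
    rw [integral_const_mul, hu]
    simp only
    rw [integral_const_mul, integral_hermiteNormalized (by omega)]
    simp
  have intW : Integrable (fun y => W y ^ n) (gaussianReal 0 1) := by
    refine (integrable_polynomial_gaussianReal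
      ((Polynomial.C (9 * (n : ℝ)) * ∑ j, U j ^ 2) ^ n)).congr (ae_of_all _ fun y => ?_)
    simp [hWdef, hU, Polynomial.eval_finsetSum]
  have hsum : ∀ y, ∑ j, a j * ((ε / n) ^ j.1 * (hermiteNormalized j.1).eval y) = a 0 + g y := by
    intro y
    rw [Fin.sum_univ_succ]
    simp [hermiteNormalized_zero, hg, hu]
  have hsum2 : ∑ j, a j ^ 2 = a 0 ^ 2 + b := by rw [Fin.sum_univ_succ]
  have cs : ∀ y, 9 * n * g y ^ 2 ≤ b * W y := by
    intro y
    have := Finset.sum_mul_sq_le_sq_mul_sq Finset.univ (fun j : Fin k => a j.succ) (fun j => u j y)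
    calc 9 * n * g y ^ 2 ≤ 9 * n * (b * ∑ j, u j y ^ 2) := by gcongr
      _ = b * W y := by rw [hWdef]; ring
  have hpt : ∀ y, (a 0 + g y) ^ (2 * n) ≤ 2 * n * a 0 ^ (2 * n - 1) * g y +
      (a 0 ^ 2 + b) ^ (n - 1) * (a 0 ^ 2 + b * W y ^ n) := by
    intro y
    refine (add_pow_two_mul_le hn _ _).trans ?_
    gcongr
    have h2 := add_mul_pow_le (n := n - 1) (sq_nonneg (a 0)) hb0 (hW0 y)
    rw [Nat.sub_add_cancel hn] at h2
    exact (pow_le_pow_left₀ (by positivity) (by linarith [cs y]) n).trans h2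
  have intR : Integrable (fun y => 2 * n * a 0 ^ (2 * n - 1) * g y +
      (a 0 ^ 2 + b) ^ (n - 1) * (a 0 ^ 2 + b * W y ^ n)) (gaussianReal 0 1) :=
    (intg.const_mul _).add (((integrable_const _).add (intW.const_mul _)).const_mul _)
  have hnn : ∀ y, 0 ≤ (a 0 + g y) ^ (2 * n) := fun y => by rw [pow_mul]; positivity
  simp_rw [hsum, hsum2]
  calc _ ≤ ∫⁻ y, ENNReal.ofReal (2 * n * a 0 ^ (2 * n - 1) * g y +
          (a 0 ^ 2 + b) ^ (n - 1) * (a 0 ^ 2 + b * W y ^ n)) ∂(gaussianReal 0 1) :=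
        lintegral_mono fun y => ENNReal.ofReal_le_ofReal (hpt y)
    _ = ENNReal.ofReal (∫ y, (2 * n * a 0 ^ (2 * n - 1) * g y +
          (a 0 ^ 2 + b) ^ (n - 1) * (a 0 ^ 2 + b * W y ^ n)) ∂(gaussianReal 0 1)) :=
        (ofReal_integral_eq_lintegral_ofReal intR
          (ae_of_all _ fun y => (hnn y).trans (hpt y))).symm
    _ ≤ _ := by
        refine ENNReal.ofReal_le_ofReal ?_
        have i1 : Integrable (fun y => a 0 ^ 2 + b * W y ^ n) (gaussianReal 0 1) :=
          (integrable_const _).add (intW.const_mul _)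
        rw [integral_add (intg.const_mul _) (i1.const_mul _), integral_const_mul, g0,
          integral_const_mul, integral_add (integrable_const _) (intW.const_mul _),
          integral_const_mul, integral_const]
        simp only [probReal_univ, one_smul, mul_zero, zero_add]
        calc (a 0 ^ 2 + b) ^ (n - 1) * (a 0 ^ 2 + b * ∫ y, W y ^ n ∂(gaussianReal 0 1))
            ≤ (a 0 ^ 2 + b) ^ (n - 1) * (a 0 ^ 2 + b * 1) := by gcongr
          _ = (a 0 ^ 2 + b) ^ n := by rw [mul_one, ← pow_succ, Nat.sub_add_cancel hn]

/-! ### Tensorization and dimension-free moment bounds. -/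

instance isProbabilityMeasure_stdGauss (d : ℕ) : IsProbabilityMeasure (stdGauss d) := by
  unfold stdGauss
  infer_instance

/-- Minkowski's inequality for finite sums, in terms of `n`-th moments. -/
theorem lintegral_finsetSum_pow_le {X ι : Type*} [MeasurableSpace X] (μ : Measure X) {n : ℕ}
    (hn : 1 ≤ n) (s : Finset ι) (f : ι → X → ℝ≥0∞) (hf : ∀ i, Measurable (f i))
    (B : ι → ℝ≥0∞) (h : ∀ i, ∫⁻ x, f i x ^ n ∂μ ≤ B i ^ n) :
    ∫⁻ x, (∑ i ∈ s, f i x) ^ n ∂μ ≤ (∑ i ∈ s, B i) ^ n := by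
  classical
  have hn0 : (n : ℝ) ≠ 0 := by positivity
  induction s using Finset.induction_on with
  | empty => simp [show n ≠ 0 by omega]
  | insert i s hi ih =>
    simp_rw [Finset.sum_insert hi]
    have key := ENNReal.lintegral_Lp_add_le (μ := μ) (p := n) (hf i).aemeasurable
      (Finset.measurable_sum s fun j _ => hf j).aemeasurable (by exact_mod_cast hn)
    simp only [Pi.add_apply, ENNReal.rpow_natCast] at key
    have root : ∀ {x b : ℝ≥0∞}, x ≤ b ^ n → x ^ (1 / (n : ℝ)) ≤ b := by
      intro x b hx
      refine (ENNReal.rpow_le_rpow hx (by positivity)).trans (le_of_eq ?_)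
      rw [← ENNReal.rpow_natCast, ← ENNReal.rpow_mul, mul_one_div_cancel hn0, ENNReal.rpow_one]
    have k2 := key.trans (add_le_add (root (h i)) (root ih))
    have k3 := ENNReal.rpow_le_rpow k2 (by positivity : (0 : ℝ) ≤ n)
    rwa [← ENNReal.rpow_mul, one_div_mul_cancel hn0, ENNReal.rpow_one, ENNReal.rpow_natCast] at k3

theorem lintegral_ofReal_sum_pow_le {X ι : Type*} [MeasurableSpace X] [Fintype ι] (μ : Measure X)
    {n : ℕ} (hn : 1 ≤ n) (f : ι → X → ℝ) (hf : ∀ i, Measurable (f i)) (hf0 : ∀ i x, 0 ≤ f i x)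
    (B : ι → ℝ) (hB : ∀ i, 0 ≤ B i)
    (h : ∀ i, ∫⁻ x, ENNReal.ofReal (f i x ^ n) ∂μ ≤ ENNReal.ofReal (B i ^ n)) :
    ∫⁻ x, ENNReal.ofReal ((∑ i, f i x) ^ n) ∂μ ≤ ENNReal.ofReal ((∑ i, B i) ^ n) := by
  have key := lintegral_finsetSum_pow_le μ hn Finset.univ (fun i x => ENNReal.ofReal (f i x))
    (fun i => (hf i).ennreal_ofReal) (fun i => ENNReal.ofReal (B i)) (fun i => by
      simpa only [← ENNReal.ofReal_pow (hf0 i _), ← ENNReal.ofReal_pow (hB i)] using h i)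
  rw [← ENNReal.ofReal_sum_of_nonneg (fun i _ => hB i),
    ← ENNReal.ofReal_pow (Finset.sum_nonneg fun i _ => hB i)] at key
  refine le_trans (le_of_eq (lintegral_congr fun x => ?_)) key
  rw [← ENNReal.ofReal_sum_of_nonneg (fun i _ => hf0 i x),
    ← ENNReal.ofReal_pow (Finset.sum_nonneg fun i _ => hf0 i x)]

/-- Tensorization of a one-dimensional hypercontractive inequality. -/
theorem hypercontractive_pi {k n : ℕ} (hn : 1 ≤ n) (u : Fin (k + 1) → ℝ → ℝ)
    (hu : ∀ j, Measurable (u j))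
    (h1 : ∀ a : Fin (k + 1) → ℝ, ∫⁻ y, ENNReal.ofReal ((∑ j, a j * u j y) ^ (2 * n))
        ∂(gaussianReal 0 1) ≤ ENNReal.ofReal ((∑ j, a j ^ 2) ^ n)) (d : ℕ) :
    ∀ c : (Fin d → Fin (k + 1)) → ℝ,
      ∫⁻ x, ENNReal.ofReal ((∑ S, c S * ∏ i, u (S i) (x i)) ^ (2 * n)) ∂(stdGauss d) ≤
        ENNReal.ofReal ((∑ S, c S ^ 2) ^ n) := by
  induction d with
  | zero =>
    intro c
    simp [pow_mul]
  | succ d ih =>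
    intro c
    -- The coefficient of `u j` in the first variable, as a function of the remaining ones.
    set F : Fin (k + 1) → (Fin d → ℝ) → ℝ := fun j x =>
      ∑ S : Fin d → Fin (k + 1), c (Fin.cons j S) * ∏ i, u (S i) (x i) with hF
    have hFm : ∀ j, Measurable (F j) := fun j => by
      refine Finset.measurable_sum _ fun S _ => ?_
      refine Measurable.const_mul (Finset.measurable_prod _ fun i _ => ?_) _
      exact (hu _).comp (measurable_pi_apply i)
    have reindex : ∀ Φ : (Fin (d + 1) → Fin (k + 1)) → ℝ,
        ∑ S, Φ S = ∑ j, ∑ S : Fin d → Fin (k + 1), Φ (Fin.cons j S) := by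
      intro Φ
      rw [← Fintype.sum_prod_type' (f := fun j S => Φ (Fin.cons j S))]
      exact (Fintype.sum_equiv (Fin.consEquiv fun _ => Fin (k + 1)) _ _ fun _ => rfl).symm
    have hsum : ∀ (y : ℝ) (x : Fin d → ℝ),
        ∑ S, c S * ∏ i, u (S i) ((Fin.cons y x : Fin (d + 1) → ℝ) i) =
          ∑ j, F j x * u j y := by
      intro y x
      rw [reindex]
      refine Finset.sum_congr rfl fun j _ => ?_
      rw [hF, Finset.sum_mul]
      refine Finset.sum_congr rfl fun S _ => ?_
      rw [Fin.prod_univ_succ]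
      simp only [Fin.cons_zero, Fin.cons_succ]
      ring
    have hmp := (measurePreserving_piFinSuccAbove (fun _ : Fin (d + 1) => gaussianReal 0 1) 0).symm
    have hmeas : Measurable fun x : Fin (d + 1) → ℝ =>
        ENNReal.ofReal ((∑ S, c S * ∏ i, u (S i) (x i)) ^ (2 * n)) := by
      refine ((Finset.measurable_sum _ fun S _ => ?_).pow_const _).ennreal_ofReal
      refine Measurable.const_mul (Finset.measurable_prod _ fun i _ => ?_) _
      exact (hu _).comp (measurable_pi_apply i)
    rw [stdGauss, ← hmp.lintegral_comp hmeas]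
    have hcons : ∀ z : ℝ × (Fin d → ℝ),
        (MeasurableEquiv.piFinSuccAbove (fun _ : Fin (d + 1) => ℝ) 0).symm z =
          (Fin.cons z.1 z.2 : Fin (d + 1) → ℝ) := by
      intro z
      ext i
      refine Fin.cases ?_ (fun i => ?_) i <;>
        simp [MeasurableEquiv.piFinSuccAbove, Fin.insertNthEquiv]
    simp_rw [hcons, hsum]
    have hmeas2 : Measurable fun z : ℝ × (Fin d → ℝ) =>
        ENNReal.ofReal ((∑ j, F j z.2 * u j z.1) ^ (2 * n)) := by
      refine ((Finset.measurable_sum _ fun j _ => ?_).pow_const _).ennreal_ofReal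
      exact ((hFm j).comp measurable_snd).mul ((hu j).comp measurable_fst)
    rw [lintegral_prod_symm _ hmeas2.aemeasurable]
    -- The one-dimensional inequality is applied in the first variable. Minkowski in `L^n` for the
    -- functions `F j ^ 2` then leaves the `2n`-th moment of each `F j`, which the induction
    -- hypothesis bounds.
    calc _ ≤ ∫⁻ x, ENNReal.ofReal ((∑ j, F j x ^ 2) ^ n) ∂(stdGauss d) :=
          lintegral_mono fun x => h1 fun j => F j x
      _ ≤ ENNReal.ofReal ((∑ j, ∑ S : Fin d → Fin (k + 1), c (Fin.cons j S) ^ 2) ^ n) := by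
          refine lintegral_ofReal_sum_pow_le _ hn _ (fun j => (hFm j).pow_const 2)
            (fun j x => sq_nonneg _) _ (fun j => Finset.sum_nonneg fun S _ => sq_nonneg _)
            fun j => ?_
          simp_rw [← pow_mul]
          exact ih _
      _ = _ := by rw [reindex]

theorem integrable_eval_stdGauss {d : ℕ} (P : MvPolynomial (Fin d) ℝ) :
    Integrable (fun x => MvPolynomial.eval x P) (stdGauss d) := by
  simp_rw [MvPolynomial.eval_eq']
  refine integrable_finsetSum _ fun m _ => Integrable.const_mul ?_ _
  exact Integrable.fintype_prod (f := fun i (y : ℝ) => y ^ m i)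
    (fun i => integrable_pow_gaussianReal (m i))

theorem measurable_mvPolynomial_eval {d : ℕ} (P : MvPolynomial (Fin d) ℝ) :
    Measurable (fun x : Fin d → ℝ => MvPolynomial.eval x P) :=
  (MvPolynomial.continuous_eval P).measurable

/-- Expansion of a polynomial in products of normalized Hermite polynomials. -/
theorem MvPolynomial.exists_hermite_expansion {d k : ℕ} (P : MvPolynomial (Fin d) ℝ)
    (hP : P.totalDegree ≤ k) :
    ∃ c : (Fin d → Fin (k + 1)) → ℝ, (∀ S, k < ∑ i, (S i).1 → c S = 0) ∧
      ∀ x, MvPolynomial.eval x P =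
        ∑ S, c S * ∏ i, (hermiteNormalized (S i).1).eval (x i) := by
  choose t ht0 ht using exists_pow_eq_sum_hermiteNormalized
  have hpow : ∀ a ≤ k, ∀ x : ℝ, x ^ a =
      ∑ j : Fin (k + 1), t a j.1 * (hermiteNormalized j.1).eval x := by
    intro a ha x
    rw [ht, Fin.sum_univ_eq_sum_range (fun j => t a j * (hermiteNormalized j).eval x) (k + 1)]
    refine Finset.sum_subset (Finset.range_mono (by omega)) fun j _ hj => ?_
    rw [ht0 a j (by simpa using hj), zero_mul]
  have hdeg : ∀ m ∈ P.support, ∑ i, m i ≤ k := fun m hm => by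
    have := (MvPolynomial.le_totalDegree hm).trans hP
    rwa [Finsupp.sum_fintype _ _ (fun _ => rfl)] at this
  refine ⟨fun S => ∑ m ∈ P.support, P.coeff m * ∏ i, t (m i) (S i).1, fun S hS => ?_, fun x => ?_⟩
  · refine Finset.sum_eq_zero fun m hm => ?_
    obtain ⟨i, -, hi⟩ := Finset.exists_lt_of_sum_lt ((hdeg m hm).trans_lt hS)
    rw [Finset.prod_eq_zero (Finset.mem_univ i) (ht0 _ _ hi), mul_zero]
  · rw [MvPolynomial.eval_eq']
    simp_rw [Finset.sum_mul]
    rw [Finset.sum_comm]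
    refine Finset.sum_congr rfl fun m hm => ?_
    have : ∀ i, x i ^ m i = ∑ j : Fin (k + 1), t (m i) j.1 * (hermiteNormalized j.1).eval (x i) :=
      fun i => hpow _ ((Finset.single_le_sum (fun j _ => Nat.zero_le (m j))
        (Finset.mem_univ i)).trans (hdeg m hm)) _
    simp_rw [this]
    rw [Finset.prod_univ_sum, Finset.mul_sum, Fintype.piFinset_univ]
    refine Finset.sum_congr rfl fun S _ => ?_
    rw [Finset.prod_mul_distrib]
    ring

/-- Parseval: orthonormality in each coordinate passes to products by Fubini. -/
theorem integral_sq_hermite_expansion {d k : ℕ} (c : (Fin d → Fin (k + 1)) → ℝ) :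
    ∫ x, (∑ S, c S * ∏ i, (hermiteNormalized (S i).1).eval (x i)) ^ 2 ∂(stdGauss d) =
      ∑ S, c S ^ 2 := by
  have e : ∀ x : Fin d → ℝ, (∑ S, c S * ∏ i, (hermiteNormalized (S i).1).eval (x i)) ^ 2 =
      ∑ S, ∑ T, c S * c T * ∏ i, ((hermiteNormalized (S i).1).eval (x i) *
        (hermiteNormalized (T i).1).eval (x i)) := by
    intro x
    rw [sq, Finset.sum_mul_sum]
    refine Finset.sum_congr rfl fun S _ => Finset.sum_congr rfl fun T _ => ?_
    rw [Finset.prod_mul_distrib]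
    ring
  have hint : ∀ S T : Fin d → Fin (k + 1), Integrable (fun x : Fin d → ℝ =>
      ∏ i, ((hermiteNormalized (S i).1).eval (x i) * (hermiteNormalized (T i).1).eval (x i)))
      (stdGauss d) := by
    intro S T
    refine Integrable.fintype_prod (f := fun i (y : ℝ) =>
      (hermiteNormalized (S i).1).eval y * (hermiteNormalized (T i).1).eval y) fun i => ?_
    simpa only [Polynomial.eval_mul] using integrable_polynomial_gaussianReal
      (hermiteNormalized (S i).1 * hermiteNormalized (T i).1)
  have hval : ∀ S T : Fin d → Fin (k + 1), ∫ x : Fin d → ℝ,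
      ∏ i, ((hermiteNormalized (S i).1).eval (x i) * (hermiteNormalized (T i).1).eval (x i))
      ∂(stdGauss d) = if S = T then 1 else 0 := by
    intro S T
    rw [stdGauss, integral_fintype_prod_eq_prod (fun i (y : ℝ) =>
      (hermiteNormalized (S i).1).eval y * (hermiteNormalized (T i).1).eval y)]
    simp_rw [integral_hermiteNormalized_mul]
    split_ifs with h
    · simp [h]
    · obtain ⟨i, hi⟩ := Function.ne_iff.1 h
      exact Finset.prod_eq_zero (Finset.mem_univ i) (if_neg fun h' => hi (Fin.ext h'))
  simp_rw [e]
  rw [integral_finsetSum _ fun S _ => integrable_finsetSum _ fun T _ => (hint S T).const_mul _]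
  refine Finset.sum_congr rfl fun S _ => ?_
  rw [integral_finsetSum _ fun T _ => (hint S T).const_mul _]
  simp_rw [integral_const_mul, hval]
  simp [sq]

/-- Dimension-free moment growth of Gaussian polynomials of bounded degree. -/
theorem exists_gaussian_moment_bound (k : ℕ) :
    ∃ A : ℝ, 1 ≤ A ∧ ∀ (d n : ℕ), 1 ≤ n → ∀ P : MvPolynomial (Fin d) ℝ, P.totalDegree ≤ k →
      ∫⁻ x, ENNReal.ofReal (MvPolynomial.eval x P ^ (2 * n)) ∂(stdGauss d) ≤
        ENNReal.ofReal ((A * n ^ k) ^ (2 * n) *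
          (∫ x, MvPolynomial.eval x P ^ 2 ∂(stdGauss d)) ^ n) := by
  obtain ⟨ε, hε0, hε1, h1⟩ := exists_hypercontractive_one_dim k
  refine ⟨(ε⁻¹) ^ k, one_le_pow₀ ((one_le_inv₀ hε0).2 hε1), fun d n hn P hP => ?_⟩
  have hn' : (1 : ℝ) ≤ n := by exact_mod_cast hn
  obtain ⟨c, hc0, hc⟩ := P.exists_hermite_expansion hP
  set r : ℝ := ε / n with hr
  have hr0 : 0 < r := by positivity
  have hr1 : r ≤ 1 := by rw [hr, div_le_one (by positivity)]; linarith
  -- The coefficients are divided in advance by `r ^ |S|` to undo the damping. As `|S| ≤ k` wherever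
  -- `c S ≠ 0`, this costs at most `r ^ (-k) = (n / ε) ^ k`.
  have key := hypercontractive_pi hn
    (fun j y => r ^ j.1 * (hermiteNormalized j.1).eval y)
    (fun j => ((hermiteNormalized j.1).continuous.measurable).const_mul _) (h1 n hn) d
    (fun S => c S * (r ^ ∑ i, (S i).1)⁻¹)
  have e : ∀ x : Fin d → ℝ, ∑ S, c S * (r ^ ∑ i, (S i).1)⁻¹ *
      ∏ i, (r ^ (S i).1 * (hermiteNormalized (S i).1).eval (x i)) = MvPolynomial.eval x P := by
    intro x
    rw [hc]
    refine Finset.sum_congr rfl fun S _ => ?_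
    rw [Finset.prod_mul_distrib, Finset.prod_pow_eq_pow_sum]
    field_simp
  simp_rw [e] at key
  refine key.trans (ENNReal.ofReal_le_ofReal ?_)
  simp_rw [hc]
  rw [integral_sq_hermite_expansion, pow_mul, ← mul_pow]
  refine pow_le_pow_left₀ (Finset.sum_nonneg fun _ _ => sq_nonneg _) ?_ n
  rw [Finset.mul_sum]
  refine Finset.sum_le_sum fun S _ => ?_
  by_cases hS : k < ∑ i, (S i).1
  · simp [hc0 S hS]
  · rw [mul_pow, mul_comm]
    refine mul_le_mul_of_nonneg_right (pow_le_pow_left₀ (by positivity) ?_ 2) (sq_nonneg _)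
    rw [← mul_pow, show ε⁻¹ * n = r⁻¹ by rw [hr, inv_div]; ring, ← inv_pow]
    exact pow_le_pow_right₀ ((one_le_inv₀ hr0).2 hr1) (by omega)

/-! ### Monte Carlo approximation by random features -/

/-- Variances of independent coordinates add, and each of the `m` summands `φ / m` has variance at
most `(B / m) ^ 2`. -/
theorem integral_sq_empirical_mean_sub_le {Ω : Type*} [MeasurableSpace Ω] (μ : Measure Ω)
    [IsProbabilityMeasure μ] {φ : Ω → ℝ} (hφ : Measurable φ) {B : ℝ} (hB : ∀ ω, |φ ω| ≤ B)
    {m : ℕ} (hm : 1 ≤ m) :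
    ∫⁻ w, ENNReal.ofReal (((∑ i, φ (w i)) / m - ∫ ω, φ ω ∂μ) ^ 2)
      ∂(Measure.pi fun _ : Fin m => μ) ≤ ENNReal.ofReal (B ^ 2 / m) := by
  have hm0 : (m : ℝ) ≠ 0 := by positivity
  have hmem : MemLp (fun ω => φ ω / m) 2 μ :=
    MemLp.of_bound (hφ.div_const _).aestronglyMeasurable (B / m) (ae_of_all _ fun ω => by
      rw [Real.norm_eq_abs, abs_div, Nat.abs_cast]
      exact div_le_div_of_nonneg_right (hB ω) (by positivity))
  have hpi : ∀ i : Fin m, MemLp (fun w : Fin m → Ω => φ (w i) / m) 2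
      (Measure.pi fun _ : Fin m => μ) := fun i =>
    hmem.comp_measurePreserving (measurePreserving_eval _ i)
  have hvar := variance_sum_pi (μ := fun _ : Fin m => μ) (X := fun _ ω => φ ω / m) fun _ => hmem
  have hsumLp : MemLp (∑ i : Fin m, fun w : Fin m → Ω => φ (w i) / m) 2
      (Measure.pi fun _ : Fin m => μ) := memLp_finsetSum' _ fun i _ => hpi i
  have hfun : (∑ i : Fin m, fun w : Fin m → Ω => φ (w i) / m) =
      fun w => (∑ i, φ (w i)) / m := by
    ext w
    simp [Finset.sum_div]
  have hmean : ∫ w, (∑ i, φ (w i)) / m ∂(Measure.pi fun _ : Fin m => μ) = ∫ ω, φ ω ∂μ := by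
    simp_rw [Finset.sum_div]
    rw [integral_finsetSum _ fun i _ => (hpi i).integrable (by norm_num)]
    have : ∀ i : Fin m, ∫ w, φ (w i) / m ∂(Measure.pi fun _ : Fin m => μ) = ∫ ω, φ ω / m ∂μ :=
      fun i => integral_comp_eval (μ := fun _ : Fin m => μ) (f := fun ω => φ ω / m)
        hmem.aestronglyMeasurable
    simp_rw [this, integral_div]
    simp
    field_simp
  rw [hfun] at hvar hsumLp
  have hVle : Var[fun ω => φ ω / m; μ] ≤ (B / m) ^ 2 := by
    refine (variance_le_expectation_sq hmem.aestronglyMeasurable).trans ?_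
    calc ∫ ω, (fun ω => φ ω / m) ω ^ 2 ∂μ ≤ ∫ _, (B / m) ^ 2 ∂μ := by
          refine integral_mono hmem.integrable_sq (integrable_const _) fun ω => ?_
          simp only
          rw [← sq_abs, abs_div, Nat.abs_cast]
          exact pow_le_pow_left₀ (by positivity)
            (div_le_div_of_nonneg_right (hB ω) (by positivity)) 2
      _ = (B / m) ^ 2 := by simp
  rw [variance_eq_integral hsumLp.aestronglyMeasurable.aemeasurable, hmean] at hvar
  have hint : Integrable (fun w : Fin m → Ω => ((∑ i, φ (w i)) / m - ∫ ω, φ ω ∂μ) ^ 2)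
      (Measure.pi fun _ : Fin m => μ) :=
    (hsumLp.sub (memLp_const (∫ ω, φ ω ∂μ))).integrable_sq
  rw [← ofReal_integral_eq_lintegral_ofReal hint (ae_of_all _ fun _ => sq_nonneg _)]
  refine ENNReal.ofReal_le_ofReal ?_
  rw [hvar, Finset.sum_const, Finset.card_univ, Fintype.card_fin, nsmul_eq_mul]
  calc (m : ℝ) * Var[fun ω => φ ω / m; μ] ≤ m * (B / m) ^ 2 := by gcongr
    _ = B ^ 2 / m := by field_simp

/-- With high probability, an empirical mean of bounded random functions is `L²`-close to its
expectation. -/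
theorem exists_event_empirical_mean_close {Ω X : Type*} [MeasurableSpace Ω] [MeasurableSpace X]
    (μ : Measure Ω) [IsProbabilityMeasure μ] (ν : Measure X) [IsProbabilityMeasure ν]
    {φ : Ω → X → ℝ} (hφ : Measurable (Function.uncurry φ)) {B : ℝ} (hB0 : 0 < B)
    (hB : ∀ ω x, |φ ω x| ≤ B) {m : ℕ} (hm : 1 ≤ m) {η : ℝ} (hη : 0 < η) :
    ∃ E : Set (Fin m → Ω), MeasurableSet E ∧
      ENNReal.ofReal (1 - η) ≤ (Measure.pi fun _ : Fin m => μ) E ∧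
      ∀ w ∈ E, ∫⁻ x, ENNReal.ofReal (((∑ i, φ (w i) x) / m - ∫ ω, φ ω x ∂μ) ^ 2) ∂ν ≤
        ENNReal.ofReal (B ^ 2 / (m * η)) := by
  have hm0 : (0 : ℝ) < m := by exact_mod_cast hm
  set π := Measure.pi fun _ : Fin m => μ
  set Ψ : (Fin m → Ω) → X → ℝ≥0∞ := fun w x =>
    ENNReal.ofReal (((∑ i, φ (w i) x) / m - ∫ ω, φ ω x ∂μ) ^ 2) with hΨ
  have hΨm : Measurable (Function.uncurry Ψ) := by
    have h1 : ∀ i, Measurable fun z : (Fin m → Ω) × X => φ (z.1 i) z.2 := fun i =>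
      hφ.comp (g := Function.uncurry φ) (f := fun z : (Fin m → Ω) × X => (z.1 i, z.2))
        (((measurable_pi_apply i).comp measurable_fst).prodMk measurable_snd)
    have h2 : Measurable fun x => ∫ ω, φ ω x ∂μ :=
      (hφ.stronglyMeasurable.integral_prod_left').measurable
    exact ((((Finset.measurable_sum _ fun i _ => h1 i).div_const _).sub
      (h2.comp measurable_snd)).pow_const 2).ennreal_ofReal
  have hΦm : Measurable fun w => ∫⁻ x, Ψ w x ∂ν := hΨm.lintegral_prod_right'
  have htot : ∫⁻ w, ∫⁻ x, Ψ w x ∂ν ∂π ≤ ENNReal.ofReal (B ^ 2 / m) := by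
    -- After Tonelli the variance bound applies at each fixed `x`.
    rw [lintegral_lintegral_swap hΨm.aemeasurable]
    calc _ ≤ ∫⁻ _, ENNReal.ofReal (B ^ 2 / m) ∂ν := lintegral_mono fun x =>
          integral_sq_empirical_mean_sub_le μ (hφ.comp measurable_prodMk_right)
            (fun ω => hB ω x) hm
      _ = _ := by simp
  -- `1 / η` times the bound on the mean error, so that Markov's inequality gives failure
  -- probability at most `η`.
  set τ := ENNReal.ofReal (B ^ 2 / (m * η)) with hτ
  have hτ0 : τ ≠ 0 := by
    rw [hτ, ne_eq, ENNReal.ofReal_eq_zero, not_le]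
    positivity
  have hE : MeasurableSet {w | ∫⁻ x, Ψ w x ∂ν ≤ τ} := measurableSet_le hΦm measurable_const
  refine ⟨_, hE, ?_, fun w hw => hw⟩
  have hc : π {w | ∫⁻ x, Ψ w x ∂ν ≤ τ}ᶜ ≤ ENNReal.ofReal η := by
    calc π {w | ∫⁻ x, Ψ w x ∂ν ≤ τ}ᶜ ≤ π {w | τ ≤ ∫⁻ x, Ψ w x ∂ν} :=
          measure_mono fun w hw => (not_le.1 (Set.mem_ofPred.not.1 hw)).le
      _ ≤ (∫⁻ w, ∫⁻ x, Ψ w x ∂ν ∂π) / τ :=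
          meas_ge_le_lintegral_div hΦm.aemeasurable hτ0 ENNReal.ofReal_ne_top
      _ ≤ ENNReal.ofReal (B ^ 2 / m) / τ := by gcongr
      _ = ENNReal.ofReal η := by
          rw [hτ, ← ENNReal.ofReal_div_of_pos (by positivity)]
          congr 1
          field_simp
  have h1 := prob_add_prob_compl (μ := π) hE
  rw [ENNReal.ofReal_sub _ hη.le, ENNReal.ofReal_one, ← h1]
  exact tsub_le_iff_right.2 (add_le_add le_rfl hc)

/-! ### Integral representation of polynomials by ReLU features -/

theorem Polynomial.abs_eval_le_of_coeff {P : Polynomial ℝ} {N : ℕ} (hN : P.natDegree ≤ N) {G : ℝ}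
    (hG : ∀ i, |P.coeff i| ≤ G) {R z : ℝ} (hR : 1 ≤ R) (hz : |z| ≤ R) :
    |P.eval z| ≤ (N + 1) * G * R ^ N := by
  rw [Polynomial.eval_eq_sum_range' (Nat.lt_succ_of_le hN)]
  refine (Finset.abs_sum_le_sum_abs _ _).trans ?_
  have : ∀ i ∈ Finset.range (N + 1), |P.coeff i * z ^ i| ≤ G * R ^ N := fun i hi => by
    rw [abs_mul, abs_pow]
    have h1 : |z| ^ i ≤ R ^ N := (pow_le_pow_left₀ (abs_nonneg _) hz i).trans
      (pow_le_pow_right₀ hR (by have := Finset.mem_range.1 hi; omega))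
    exact mul_le_mul (hG i) h1 (by positivity) ((abs_nonneg _).trans (hG i))
  refine (Finset.sum_le_card_nsmul _ _ _ this).trans (le_of_eq ?_)
  simp
  ring

theorem Polynomial.abs_coeff_derivative_le {P : Polynomial ℝ} {N : ℕ} (hN : P.natDegree ≤ N)
    {G : ℝ} (hG : ∀ i, |P.coeff i| ≤ G) (i : ℕ) : |P.derivative.coeff i| ≤ N * G := by
  have hG0 : 0 ≤ G := (abs_nonneg _).trans (hG 0)
  rw [Polynomial.coeff_derivative, abs_mul]
  by_cases h : i + 1 ≤ N
  · rw [mul_comm]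
    refine mul_le_mul ?_ (hG _) (abs_nonneg _) (by positivity)
    rw [abs_of_nonneg (by positivity)]
    exact_mod_cast h
  · rw [Polynomial.coeff_eq_zero_of_natDegree_lt (by omega)]
    simp
    positivity

theorem continuous_relu : Continuous relu := continuous_id.max continuous_const

theorem abs_relu_le (z : ℝ) : |relu z| ≤ |z| := by
  rw [relu, abs_of_nonneg (le_max_right _ _)]
  exact max_le (le_abs_self z) (abs_nonneg z)

theorem relu_of_nonneg {z : ℝ} (hz : 0 ≤ z) : relu z = z := max_eq_left hz

theorem relu_of_nonpos {z : ℝ} (hz : z ≤ 0) : relu z = 0 := max_eq_right hz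

/-- First-order Taylor formula at `-R` with integral remainder: after `t = -b`, the ReLU cuts the
integral off at `t = z`, where `P'(t) (z - t) + P(t)` is an antiderivative. -/
theorem Polynomial.taylor_relu (P : Polynomial ℝ) {R z : ℝ} (hz : |z| ≤ R) :
    ∫ b in (-R)..R, P.derivative.derivative.eval (-b) * relu (z + b) =
      P.eval z - (P.eval (-R) + P.derivative.eval (-R) * (z + R)) := by
  obtain ⟨h1, h2⟩ := abs_le.1 hz
  have hcont : Continuous fun t => P.derivative.derivative.eval t * relu (z - t) :=
    P.derivative.derivative.continuous.mul (continuous_relu.comp (by fun_prop))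
  have e1 : ∫ b in (-R)..R, P.derivative.derivative.eval (-b) * relu (z + b) =
      ∫ t in (-R)..R, P.derivative.derivative.eval t * relu (z - t) := by
    have := intervalIntegral.integral_comp_neg (a := -R) (b := R)
      (fun t => P.derivative.derivative.eval t * relu (z - t))
    simp only [neg_neg, sub_neg_eq_add] at this
    exact this
  rw [e1, ← intervalIntegral.integral_add_adjacent_intervals (b := z)
    (hcont.intervalIntegrable _ _) (hcont.intervalIntegrable _ _)]
  have e2 : ∫ t in z..R, P.derivative.derivative.eval t * relu (z - t) = 0 := by
    rw [intervalIntegral.integral_congr (g := fun _ => 0), intervalIntegral.integral_zero]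
    intro t ht
    rw [Set.uIcc_of_le h2] at ht
    simp [relu_of_nonpos (by linarith [ht.1] : z - t ≤ 0)]
  have e3 : ∫ t in (-R)..z, P.derivative.derivative.eval t * relu (z - t) =
      ∫ t in (-R)..z, P.derivative.derivative.eval t * (z - t) := by
    refine intervalIntegral.integral_congr fun t ht => ?_
    rw [Set.uIcc_of_le h1] at ht
    rw [relu_of_nonneg (by linarith [ht.2])]
  have hd : ∀ t ∈ Set.uIcc (-R) z, HasDerivAt
      (fun t => P.derivative.eval t * (z - t) + P.eval t)
      (P.derivative.derivative.eval t * (z - t)) t := by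
    intro t _
    refine (((P.derivative.hasDerivAt t).mul ((hasDerivAt_id t).const_sub z)).add
      (P.hasDerivAt t)).congr_deriv ?_
    simp
  have hc2 : Continuous fun t => P.derivative.derivative.eval t * (z - t) :=
    P.derivative.derivative.continuous.mul (by fun_prop)
  rw [e2, e3, intervalIntegral.integral_eq_sub_of_hasDerivAt hd (hc2.intervalIntegrable _ _)]
  ring

instance isProbabilityMeasure_signLaw : IsProbabilityMeasure signLaw := by
  constructor
  simp [signLaw, ENNReal.inv_two_add_inv_two]

theorem integral_signLaw (f : ℝ → ℝ) : ∫ a, f a ∂signLaw = (f 1 + f (-1)) / 2 := by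
  have h : ∀ c : ℝ, Integrable f ((2⁻¹ : ℝ≥0∞) • Measure.dirac c) := fun c =>
    (integrable_dirac (by simp)).smul_measure (by simp)
  rw [signLaw, integral_add_measure (h 1) (h (-1)), integral_smul_measure, integral_smul_measure,
    integral_dirac, integral_dirac]
  simp
  ring

theorem integral_densityLaw {ρ : ℝ → ℝ} (hρ : Measurable ρ) (hρ0 : ∀ t, 0 ≤ ρ t) (f : ℝ → ℝ) :
    ∫ t, f t ∂(densityLaw ρ) = ∫ t, ρ t * f t := by
  rw [densityLaw, integral_withDensity_eq_integral_toReal_smul hρ.ennreal_ofReal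
    (ae_of_all _ fun _ => ENNReal.ofReal_lt_top)]
  simp [ENNReal.toReal_ofReal (hρ0 _)]

/-- Biases in `[R, 2R]` keep the ReLU active on all of `[-R, R]`. Using this for `z` and `-z`
produces every affine function, hence the Taylor part at `-R`. -/
theorem integral_const_mul_add_relu {R z : ℝ} (hz : |z| ≤ R) (β : ℝ) :
    ∫ b in R..(2 * R), β * relu (z + b) = β * (z * R + 3 / 2 * R ^ 2) := by
  obtain ⟨h1, h2⟩ := abs_le.1 hz
  have e : ∫ b in R..(2 * R), β * relu (z + b) = ∫ b in R..(2 * R), β * (z + b) := by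
    refine intervalIntegral.integral_congr fun t ht => ?_
    rw [Set.uIcc_of_le (by linarith)] at ht
    rw [relu_of_nonneg (by linarith [ht.1])]
  rw [e, intervalIntegral.integral_const_mul, intervalIntegral.integral_add (by simp) (by simp),
    intervalIntegral.integral_const, integral_id, smul_eq_mul]
  ring

/-- The ReLU density of a polynomial `P` on `[-R, R]`, for features `relu (z + b)`. -/
noncomputable def reluDensity (P : Polynomial ℝ) (R β b : ℝ) : ℝ :=
  Set.indicator (Set.Ioc (-R) R) (fun b => P.eval (-b)) b +
    Set.indicator (Set.Ioc R (2 * R)) (fun _ => β) b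

theorem measurable_reluDensity (P : Polynomial ℝ) (R β : ℝ) : Measurable (reluDensity P R β) :=
  ((P.continuous.comp continuous_neg).measurable.indicator measurableSet_Ioc).add
    (measurable_const.indicator measurableSet_Ioc)

theorem integral_reluDensity_mul (P : Polynomial ℝ) {R : ℝ} (hR : 0 ≤ R) (β z : ℝ) :
    ∫ b, reluDensity P R β b * relu (z + b) =
      (∫ b in (-R)..R, P.eval (-b) * relu (z + b)) + ∫ b in R..(2 * R), β * relu (z + b) := by
  have c1 : Continuous fun b => P.eval (-b) * relu (z + b) :=
    (P.continuous.comp continuous_neg).mul (continuous_relu.comp (by fun_prop))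
  have c2 : Continuous fun b => β * relu (z + b) :=
    continuous_const.mul (continuous_relu.comp (by fun_prop))
  have e : ∀ b, reluDensity P R β b * relu (z + b) =
      Set.indicator (Set.Ioc (-R) R) (fun b => P.eval (-b) * relu (z + b)) b +
        Set.indicator (Set.Ioc R (2 * R)) (fun b => β * relu (z + b)) b := by
    intro b
    simp only [reluDensity, Set.indicator_apply]
    split_ifs <;> ring
  simp_rw [e]
  rw [integral_add ((integrable_indicator_iff measurableSet_Ioc).2 c1.integrableOn_Ioc)
    ((integrable_indicator_iff measurableSet_Ioc).2 c2.integrableOn_Ioc),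
    integral_indicator measurableSet_Ioc, integral_indicator measurableSet_Ioc,
    intervalIntegral.integral_of_le (by linarith), intervalIntegral.integral_of_le (by linarith)]

theorem abs_reluDensity_le {P : Polynomial ℝ} {R β L : ℝ} (hL : 0 ≤ L) (hβ : |β| ≤ L)
    (hP : ∀ z, |z| ≤ R → |P.eval z| ≤ L) (b : ℝ) : |reluDensity P R β b| ≤ L := by
  simp only [reluDensity, Set.indicator_apply]
  split_ifs with h1 h2 h2
  · exact absurd h2.1 (not_lt.2 h1.2)
  · rw [add_zero]
    exact hP _ (by rw [abs_neg, abs_le]; exact ⟨h1.1.le, h1.2⟩)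
  · rwa [zero_add]
  · simpa using hL

theorem reluDensity_eq_zero {P : Polynomial ℝ} {R β b : ℝ} (hb : 2 * R < |b|) :
    reluDensity P R β b = 0 := by
  have hR : R < |b| ∨ R < 0 := by
    by_contra! h
    linarith
  simp only [reluDensity, Set.indicator_apply]
  rw [if_neg, if_neg, add_zero]
  · rintro ⟨h1, h2⟩
    have : 0 ≤ R := by linarith
    rw [abs_of_nonneg (by linarith)] at hb
    linarith
  · rintro ⟨h1, h2⟩
    have h3 : |b| ≤ R := abs_le.2 ⟨h1.le, h2⟩
    linarith [abs_nonneg b]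

/-- On `[-R, R]` a polynomial is an average of ReLU features with bounded weights. -/
theorem exists_relu_representation {q : ℕ} (hq : 1 ≤ q) {s κ M : ℝ} (hs : 0 < s) (hκ : 0 < κ)
    {ρ : ℝ → ℝ} (hρ : IsHeavyTailedDensity s κ M ρ) {P : Polynomial ℝ} (hdeg : P.natDegree ≤ q)
    {G : ℝ} (hG : ∀ i, |P.coeff i| ≤ G) {R : ℝ} (hR : 1 ≤ R) :
    ∃ W : ℝ × ℝ → ℝ, Measurable W ∧
      (∀ v, |W v| ≤ 4 * (q + 1) ^ 3 * G * κ⁻¹ * 3 ^ s * R ^ s * R ^ (q - 1)) ∧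
      (∀ v, W v ≠ 0 → |v.1| = 1 ∧ |v.2| ≤ 2 * R) ∧
      ∀ z, |z| ≤ R →
        ∫ v, W v * relu (v.1 * z + v.2) ∂(signLaw.prod (densityLaw ρ)) = P.eval z := by
  have := hρ.isProb
  have hR0 : 0 < R := by linarith
  have hG0 : 0 ≤ G := (abs_nonneg _).trans (hG 0)
  have hρpos : ∀ t, 0 < ρ t := fun t =>
    lt_of_lt_of_le (by positivity) (hρ.lower_bound t)
  set A : ℝ := P.eval (-R) + R * P.derivative.eval (-R) with hA
  set B : ℝ := P.derivative.eval (-R) with hB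
  -- The affine Taylor part is `A + B z`. The two signs contribute `β₁ (R z + 3/2 R ^ 2) + β₂ (-R z
  -- + 3/2 R ^ 2)`; `β₁` and `β₂` solve the resulting linear system.
  set β₁ : ℝ := (A / (3 / 2 * R ^ 2) + B / R) / 2 with hβ₁
  set β₂ : ℝ := (A / (3 / 2 * R ^ 2) - B / R) / 2 with hβ₂
  set U : ℝ := 2 * (q + 1) ^ 3 * G * R ^ (q - 1) with hU
  have hU0 : 0 ≤ U := by positivity
  have hq' : (1 : ℝ) ≤ q := by exact_mod_cast hq
  have hqc : ((q - 1 : ℕ) : ℝ) + 1 = q := by rw [Nat.cast_sub hq]; simp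
  have d1 : P.derivative.natDegree ≤ q - 1 := (Polynomial.natDegree_derivative_le P).trans (by omega)
  have d2 : P.derivative.derivative.natDegree ≤ q - 1 :=
    (Polynomial.natDegree_derivative_le _).trans (by omega)
  have b0 := fun z (hz : |z| ≤ R) => Polynomial.abs_eval_le_of_coeff hdeg hG hR hz
  have g1 := Polynomial.abs_coeff_derivative_le hdeg hG
  have b1 := fun z (hz : |z| ≤ R) => Polynomial.abs_eval_le_of_coeff d1 g1 hR hz
  have g2 := Polynomial.abs_coeff_derivative_le (d1.trans (Nat.sub_le q 1)) g1
  have b2 := fun z (hz : |z| ≤ R) => Polynomial.abs_eval_le_of_coeff d2 g2 hR hz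
  rw [hqc] at b1 b2
  have hnR : |-R| ≤ R := by rw [abs_neg, abs_of_pos hR0]
  have hBR : |B / R| ≤ (q + 1) ^ 3 * G * R ^ (q - 1) := by
    rw [abs_div, abs_of_pos hR0, div_le_iff₀ hR0]
    calc |B| ≤ q * (q * G) * R ^ (q - 1) := b1 _ hnR
      _ ≤ (q + 1) ^ 3 * G * R ^ (q - 1) * 1 := by
          rw [mul_one, ← mul_assoc]
          gcongr
          nlinarith
      _ ≤ _ := by gcongr
  have hAR : |A / (3 / 2 * R ^ 2)| ≤ 2 * (q + 1) ^ 3 * G * R ^ (q - 1) := by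
    rw [abs_div, abs_of_pos (by positivity : 0 < 3 / 2 * R ^ 2), div_le_iff₀ (by positivity)]
    have hRq : R ^ q = R * R ^ (q - 1) := by rw [← pow_succ', Nat.sub_add_cancel hq]
    calc |A| ≤ |P.eval (-R)| + R * |B| := by
          refine (abs_add_le _ _).trans ?_
          rw [abs_mul, abs_of_pos hR0]
      _ ≤ (q + 1) * G * R ^ q + R * (q * (q * G) * R ^ (q - 1)) := by
          gcongr
          · exact b0 _ hnR
          · exact b1 _ hnR
      _ = ((q + 1) + q * q) * (G * R ^ (q - 1) * R) := by rw [hRq]; ring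
      _ ≤ (2 * (q + 1) ^ 3) * (G * R ^ (q - 1) * (3 / 2 * R ^ 2)) := by
          gcongr
          · nlinarith
          · nlinarith
      _ = _ := by ring
  have hL : 2 * (q + 1) ^ 3 * G * R ^ (q - 1) = 2 * ((q + 1) ^ 3 * G * R ^ (q - 1)) := by ring
  rw [hL] at hAR
  have hβ₁' : |β₁| ≤ U := by
    have := abs_add_le (A / (3 / 2 * R ^ 2)) (B / R)
    rw [hβ₁, abs_div, abs_of_pos (two_pos : (0 : ℝ) < 2), hU, hL]
    linarith [abs_nonneg (B / R)]
  have hβ₂' : |β₂| ≤ U := by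
    have := abs_sub (A / (3 / 2 * R ^ 2)) (B / R)
    rw [hβ₂, abs_div, abs_of_pos (two_pos : (0 : ℝ) < 2), hU, hL]
    linarith [abs_nonneg (B / R)]
  set u₁ := reluDensity P.derivative.derivative R β₁ with hu₁
  set u₂ := reluDensity 0 R β₂ with hu₂
  have hu₁' : ∀ b, |u₁ b| ≤ U := abs_reluDensity_le hU0 hβ₁' fun z hz => by
    refine (b2 z hz).trans ?_
    have hcube : (q : ℝ) ^ 3 ≤ 2 * (q + 1) ^ 3 :=
      (pow_le_pow_left₀ (by positivity) (by linarith) 3).trans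
        (le_mul_of_one_le_left (by positivity) one_le_two)
    calc (q : ℝ) * (q * (q * G)) * R ^ (q - 1) = (q : ℝ) ^ 3 * (G * R ^ (q - 1)) := by ring
      _ ≤ 2 * (q + 1) ^ 3 * (G * R ^ (q - 1)) := by gcongr
      _ = U := by rw [hU]; ring
  have hu₂' : ∀ b, |u₂ b| ≤ U := abs_reluDensity_le hU0 hβ₂' fun z _ => by simpa using hU0
  have hu₁m : Measurable u₁ := measurable_reluDensity _ _ _
  have hu₂m : Measurable u₂ := measurable_reluDensity _ _ _
  -- Importance weights: the factor 2 undoes the probability `1/2` of each sign, and the division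
  -- undoes the bias density.
  set W : ℝ × ℝ → ℝ := fun v => if v.1 = 1 then 2 * u₁ v.2 / ρ v.2 else
    if v.1 = -1 then 2 * u₂ v.2 / ρ v.2 else 0 with hW
  have hWm : Measurable W := by
    have hm : ∀ c : ℝ, MeasurableSet {v : ℝ × ℝ | v.1 = c} := fun c =>
      measurable_fst (measurableSet_singleton c)
    have hr : Measurable fun v : ℝ × ℝ => ρ v.2 := hρ.measurable.comp measurable_snd
    exact Measurable.ite (hm 1) (((hu₁m.comp measurable_snd).const_mul 2).div hr)
      (Measurable.ite (hm (-1)) (((hu₂m.comp measurable_snd).const_mul 2).div hr)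
        measurable_const)
  set Z : ℝ := 4 * (q + 1) ^ 3 * G * κ⁻¹ * 3 ^ s * R ^ s * R ^ (q - 1) with hZ
  have hZ0 : 0 ≤ Z := by positivity
  have hquot : ∀ (u : ℝ → ℝ), (∀ b, |u b| ≤ U) → (∀ b, 2 * R < |b| → u b = 0) →
      ∀ b, |2 * u b / ρ b| ≤ Z := by
    intro u hu hu0 b
    by_cases hb : 2 * R < |b|
    · simpa [hu0 b hb] using hZ0
    -- Here `|b| + 1 ≤ 2R + 1 ≤ 3R`, so the heavy tail limits the cost of dividing by `ρ` to order
    -- `R ^ s`.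
    have h1 : κ * (3 * R) ^ (-s) ≤ ρ b := by
      refine le_trans ?_ (hρ.lower_bound b)
      gcongr ?_ * ?_
      refine Real.rpow_le_rpow_of_nonpos (by positivity) (by linarith [not_lt.1 hb]) (by linarith)
    rw [abs_div, abs_of_pos (hρpos b), abs_mul, abs_two, div_le_iff₀ (hρpos b)]
    have h2 : Z * (κ * (3 * R) ^ (-s)) = 2 * U := by
      rw [hZ, hU, Real.rpow_neg (by positivity), Real.mul_rpow (by norm_num) hR0.le]
      have : (3 : ℝ) ^ s ≠ 0 := by positivity
      have : R ^ s ≠ 0 := by positivity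
      field_simp
      ring
    calc 2 * |u b| ≤ 2 * U := by linarith [hu b]
      _ = Z * (κ * (3 * R) ^ (-s)) := h2.symm
      _ ≤ Z * ρ b := by gcongr
  have hWb : ∀ v, |W v| ≤ Z := by
    intro v
    simp only [hW]
    split_ifs
    · exact hquot u₁ hu₁' (fun b hb => reluDensity_eq_zero hb) v.2
    · exact hquot u₂ hu₂' (fun b hb => reluDensity_eq_zero hb) v.2
    · simpa using hZ0
  have hWs : ∀ v, W v ≠ 0 → |v.1| = 1 ∧ |v.2| ≤ 2 * R := by
    intro v hv
    have hb : |v.2| ≤ 2 * R := by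
      by_contra! hb
      apply hv
      simp [hW, hu₁, hu₂, reluDensity_eq_zero hb]
    refine ⟨?_, hb⟩
    by_contra ha
    apply hv
    have h1 : v.1 ≠ 1 := fun h => ha (by simp [h])
    have h2 : v.1 ≠ -1 := fun h => ha (by simp [h])
    simp [hW, h1, h2]
  refine ⟨W, hWm, hWb, hWs, fun z hz => ?_⟩
  have hint : Integrable (fun v : ℝ × ℝ => W v * relu (v.1 * z + v.2))
      (signLaw.prod (densityLaw ρ)) := by
    refine Integrable.of_bound ((hWm.mul (continuous_relu.measurable.comp
      (by fun_prop))).aestronglyMeasurable) (Z * (3 * R)) (ae_of_all _ fun v => ?_)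
    rw [Real.norm_eq_abs, abs_mul]
    by_cases hv : W v = 0
    · simp [hv]
      positivity
    obtain ⟨h1, h2⟩ := hWs v hv
    refine mul_le_mul (hWb v) ?_ (abs_nonneg _) hZ0
    refine (abs_relu_le _).trans ((abs_add_le _ _).trans ?_)
    rw [abs_mul, h1]
    linarith
  rw [integral_prod _ hint, integral_signLaw, integral_densityLaw hρ.measurable
    (fun t => (hρpos t).le), integral_densityLaw hρ.measurable (fun t => (hρpos t).le)]
  have e1 : ∀ b, ρ b * (W (1, b) * relu (1 * z + b)) = 2 * (u₁ b * relu (z + b)) := by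
    intro b
    have := (hρpos b).ne'
    simp only [hW, if_true, one_mul]
    field_simp
  have e2 : ∀ b, ρ b * (W (-1, b) * relu (-1 * z + b)) = 2 * (u₂ b * relu (-z + b)) := by
    intro b
    have := (hρpos b).ne'
    simp only [hW, if_true, neg_mul, one_mul, show (-1 : ℝ) ≠ 1 by norm_num, if_false]
    field_simp
  simp only [e1, e2]
  rw [integral_const_mul, integral_const_mul, hu₁, hu₂, integral_reluDensity_mul _ hR0.le,
    integral_reluDensity_mul _ hR0.le, P.taylor_relu hz, integral_const_mul_add_relu hz,
    integral_const_mul_add_relu (by rwa [abs_neg]), hβ₁, hβ₂]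
  simp only [Polynomial.eval_zero, zero_mul, intervalIntegral.integral_zero, zero_add]
  rw [← hB, show P.eval (-R) = A - R * B by rw [hA]; ring]
  field_simp
  ring

/-! ### Squared Gaussian norms of polynomials -/

theorem gaussNormSq_eq_lintegral {d : ℕ} (f : (Fin d → ℝ) → ℝ) :
    gaussNormSq f = ∫⁻ x, ENNReal.ofReal (f x ^ 2) ∂(stdGauss d) := by
  have h := eLpNorm_nnreal_pow_eq_lintegral (f := f) (μ := stdGauss d) (p := 2) (by norm_num)
  norm_num at h
  rw [gaussNormSq, h]
  refine lintegral_congr fun x => ?_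
  rw [Real.enorm_eq_ofReal_abs, ← ENNReal.ofReal_pow (abs_nonneg _), sq_abs]

theorem gaussNormSq_mvPolynomial {d : ℕ} (P : MvPolynomial (Fin d) ℝ) :
    gaussNormSq (fun x => MvPolynomial.eval x P) =
      ENNReal.ofReal (∫ x, MvPolynomial.eval x P ^ 2 ∂(stdGauss d)) := by
  rw [gaussNormSq_eq_lintegral, ofReal_integral_eq_lintegral_ofReal _
    (ae_of_all _ fun _ => sq_nonneg _)]
  exact (integrable_eval_stdGauss (P ^ 2)).congr (ae_of_all _ fun x => by simp)

/-! ### Lipschitz composition, tails and constants uniform in the dimension. -/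

theorem abs_pow_sub_pow_le_one_add (a b : ℝ) (i : ℕ) :
    |a ^ i - b ^ i| ≤ i * (1 + |a| + |b|) ^ i * |a - b| := by
  induction i with
  | zero => simp
  | succ i ih =>
    have h1 : 1 ≤ 1 + |a| + |b| := by linarith [abs_nonneg a, abs_nonneg b]
    have h2 : |b| ^ i ≤ (1 + |a| + |b|) ^ i :=
      pow_le_pow_left₀ (abs_nonneg _) (by linarith [abs_nonneg a]) i
    have e : a ^ (i + 1) - b ^ (i + 1) = a * (a ^ i - b ^ i) + b ^ i * (a - b) := by ring
    set T := 1 + |a| + |b| with hT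
    calc |a ^ (i + 1) - b ^ (i + 1)| ≤ |a| * |a ^ i - b ^ i| + |b| ^ i * |a - b| := by
          rw [e, ← abs_mul, ← abs_pow, ← abs_mul]
          exact abs_add_le _ _
      _ ≤ T * (i * T ^ i * |a - b|) + T ^ i * |a - b| := by
          gcongr
          linarith [abs_nonneg b]
      _ ≤ T * (i * T ^ i * |a - b|) + T * (T ^ i * |a - b|) := by
          exact add_le_add le_rfl (le_mul_of_one_le_left
            (mul_nonneg (pow_nonneg (zero_le_one.trans h1) i) (abs_nonneg _)) h1)
      _ = _ := by push_cast; ring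

theorem Polynomial.abs_eval_sub_eval_le {g : Polynomial ℝ} {q : ℕ} (hq : g.natDegree ≤ q) {G : ℝ}
    (hG : ∀ i, |g.coeff i| ≤ G) (a b : ℝ) :
    |g.eval a - g.eval b| ≤ (q + 1) * G * q * (1 + |a| + |b|) ^ q * |a - b| := by
  have h1 : 1 ≤ 1 + |a| + |b| := by linarith [abs_nonneg a, abs_nonneg b]
  have hG0 : 0 ≤ G := (abs_nonneg _).trans (hG 0)
  rw [Polynomial.eval_eq_sum_range' (Nat.lt_succ_of_le hq),
    Polynomial.eval_eq_sum_range' (Nat.lt_succ_of_le hq), ← Finset.sum_sub_distrib]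
  refine (Finset.abs_sum_le_sum_abs _ _).trans ?_
  have : ∀ i ∈ Finset.range (q + 1), |g.coeff i * a ^ i - g.coeff i * b ^ i| ≤
      G * (q * (1 + |a| + |b|) ^ q * |a - b|) := fun i hi => by
    have hi' : i ≤ q := Nat.lt_succ_iff.1 (Finset.mem_range.1 hi)
    rw [← mul_sub, abs_mul]
    refine mul_le_mul (hG i) ((abs_pow_sub_pow_le_one_add a b i).trans ?_) (abs_nonneg _) hG0
    have h2 : (1 + |a| + |b|) ^ i ≤ (1 + |a| + |b|) ^ q := pow_le_pow_right₀ h1 hi'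
    gcongr
  refine (Finset.sum_le_card_nsmul _ _ _ this).trans (le_of_eq ?_)
  simp
  ring

theorem one_add_add_pow_le {x y : ℝ} (hx : 0 ≤ x) (hy : 0 ≤ y) (N : ℕ) :
    (1 + x + y) ^ N ≤ 3 ^ N * (1 + x ^ N + y ^ N) := by
  have hx' := pow_nonneg hx N
  have hy' := pow_nonneg hy N
  have key : ∀ M : ℝ, 0 ≤ M → 1 + x + y ≤ 3 * M → M ^ N ≤ 1 + x ^ N + y ^ N →
      (1 + x + y) ^ N ≤ 3 ^ N * (1 + x ^ N + y ^ N) := by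
    intro M hM h1 h2
    calc (1 + x + y) ^ N ≤ (3 * M) ^ N := pow_le_pow_left₀ (by positivity) h1 N
      _ = 3 ^ N * M ^ N := mul_pow _ _ _
      _ ≤ _ := by gcongr
  rcases le_total x y with h | h
  · rcases le_total 1 y with h' | h'
    · exact key y hy (by linarith) (by linarith)
    · exact key 1 zero_le_one (by linarith) (by rw [one_pow]; linarith)
  · rcases le_total 1 x with h' | h'
    · exact key x hx (by linarith) (by linarith)
    · exact key 1 zero_le_one (by linarith) (by rw [one_pow]; linarith)

/-- Composition with a fixed univariate polynomial is Lipschitz in `L²` on bounded sets of Gaussian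
polynomials of bounded degree. -/
theorem exists_composition_lipschitz (k q : ℕ) (hq : 1 ≤ q) (G S : ℝ) :
    ∃ C : ℝ, 0 ≤ C ∧ ∀ (d : ℕ) (g : Polynomial ℝ), g.natDegree ≤ q → (∀ i, |g.coeff i| ≤ G) →
      ∀ P Q : MvPolynomial (Fin d) ℝ, P.totalDegree ≤ k → Q.totalDegree ≤ k →
      ∫ x, MvPolynomial.eval x P ^ 2 ∂(stdGauss d) ≤ S ^ 2 →
      ∫ x, MvPolynomial.eval x Q ^ 2 ∂(stdGauss d) ≤ S ^ 2 →
      ∀ t : ℝ, 0 < t → ∫ x, MvPolynomial.eval x (P - Q) ^ 2 ∂(stdGauss d) ≤ t →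
      ∫⁻ x, ENNReal.ofReal ((g.eval (MvPolynomial.eval x P) - g.eval (MvPolynomial.eval x Q)) ^ 2)
        ∂(stdGauss d) ≤ ENNReal.ofReal (C * t) := by
  obtain ⟨A, hA1, hA⟩ := exists_gaussian_moment_bound k
  set L : ℝ := (q + 1) * G * q with hL
  set D : ℝ := (A * (2 : ℕ) ^ k) ^ (2 * 2) with hD
  set F : ℝ := (A * (2 * q : ℕ) ^ k) ^ (2 * (2 * q)) * (S ^ 2) ^ (2 * q) with hF
  have hD0 : 0 ≤ D := by positivity
  have hF0 : 0 ≤ F := by positivity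
  refine ⟨L ^ 2 * (D + 3 ^ (4 * q) * (1 + F + F)), by positivity, ?_⟩
  intro d g hg hG P Q hP hQ hPS hQS t ht hPQ
  have hmom : ∀ P : MvPolynomial (Fin d) ℝ, P.totalDegree ≤ k →
      ∫ x, MvPolynomial.eval x P ^ 2 ∂(stdGauss d) ≤ S ^ 2 →
      ∫⁻ x, ENNReal.ofReal (MvPolynomial.eval x P ^ (4 * q)) ∂(stdGauss d) ≤ ENNReal.ofReal F := by
    intro P hP hS
    have h := hA d (2 * q) (by omega) P hP
    rw [show 2 * (2 * q) = 4 * q by ring] at h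
    refine h.trans (ENNReal.ofReal_le_ofReal ?_)
    rw [hF, show 2 * (2 * q) = 4 * q by ring]
    have : 0 ≤ ∫ x, MvPolynomial.eval x P ^ 2 ∂(stdGauss d) := integral_nonneg fun _ => sq_nonneg _
    gcongr
  have hdiff : ∫⁻ x, ENNReal.ofReal (MvPolynomial.eval x (P - Q) ^ 4) ∂(stdGauss d) ≤
      ENNReal.ofReal (D * t ^ 2) := by
    refine (hA d 2 one_le_two (P - Q)
      ((MvPolynomial.totalDegree_sub _ _).trans (max_le hP hQ))).trans (ENNReal.ofReal_le_ofReal ?_)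
    have : 0 ≤ ∫ x, MvPolynomial.eval x (P - Q) ^ 2 ∂(stdGauss d) :=
      integral_nonneg fun _ => sq_nonneg _
    rw [hD]
    gcongr
  have hm1 := measurable_mvPolynomial_eval P
  have hm2 := measurable_mvPolynomial_eval Q
  have hm3 := measurable_mvPolynomial_eval (P - Q)
  have even_nonneg : ∀ y : ℝ, 0 ≤ y ^ (4 * q) := fun y => by
    rw [show 4 * q = 2 * (2 * q) by ring, pow_mul]; positivity
  have hpt : ∀ x : Fin d → ℝ,
      (g.eval (MvPolynomial.eval x P) - g.eval (MvPolynomial.eval x Q)) ^ 2 ≤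
        L ^ 2 / t * MvPolynomial.eval x (P - Q) ^ 4 +
          L ^ 2 * t * 3 ^ (4 * q) * (1 + MvPolynomial.eval x P ^ (4 * q) +
            MvPolynomial.eval x Q ^ (4 * q)) := by
    intro x
    rw [map_sub]
    set a := MvPolynomial.eval x P
    set b := MvPolynomial.eval x Q
    have h1 := Polynomial.abs_eval_sub_eval_le hg hG a b
    have h2 := one_add_add_pow_le (abs_nonneg a) (abs_nonneg b) (4 * q)
    have ev : Even (4 * q) := ⟨2 * q, by ring⟩
    rw [ev.pow_abs, ev.pow_abs] at h2
    set T := (1 + |a| + |b|) ^ q with hT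
    have hT4 : (1 + |a| + |b|) ^ (4 * q) = T ^ 4 := by rw [hT, ← pow_mul]; congr 1; ring
    rw [hT4] at h2
    -- AM–GM weighted by `t`: the fourth moment of `P - Q` is at most `D t ^ 2`, so both terms
    -- integrate to order `t`.
    have h3 : (a - b) ^ 2 * T ^ 2 ≤ (a - b) ^ 4 / t + t * T ^ 4 := by
      have h4 : 0 ≤ ((a - b) ^ 2 / t - T ^ 2) ^ 2 * t := by positivity
      have h5 : ((a - b) ^ 2 / t - T ^ 2) ^ 2 * t =
          (a - b) ^ 4 / t + t * T ^ 4 - 2 * ((a - b) ^ 2 * T ^ 2) := by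
        field_simp
        ring
      have h6 : 0 ≤ (a - b) ^ 2 * T ^ 2 := by positivity
      linarith
    calc (g.eval a - g.eval b) ^ 2 = |g.eval a - g.eval b| ^ 2 := (sq_abs _).symm
      _ ≤ (L * T * |a - b|) ^ 2 := pow_le_pow_left₀ (abs_nonneg _) h1 2
      _ = L ^ 2 * ((a - b) ^ 2 * T ^ 2) := by rw [mul_pow, sq_abs]; ring
      _ ≤ L ^ 2 * ((a - b) ^ 4 / t + t * (3 ^ (4 * q) * (1 + a ^ (4 * q) + b ^ (4 * q)))) := by
          gcongr
          exact h3.trans (by gcongr)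
      _ = _ := by ring
  have split : ∀ x : Fin d → ℝ, ENNReal.ofReal (L ^ 2 / t * MvPolynomial.eval x (P - Q) ^ 4 +
          L ^ 2 * t * 3 ^ (4 * q) * (1 + MvPolynomial.eval x P ^ (4 * q) +
            MvPolynomial.eval x Q ^ (4 * q))) =
      ENNReal.ofReal (L ^ 2 / t) * ENNReal.ofReal (MvPolynomial.eval x (P - Q) ^ 4) +
        ENNReal.ofReal (L ^ 2 * t * 3 ^ (4 * q)) * (1 +
          ENNReal.ofReal (MvPolynomial.eval x P ^ (4 * q)) +
            ENNReal.ofReal (MvPolynomial.eval x Q ^ (4 * q))) := by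
    intro x
    have n1 := even_nonneg (MvPolynomial.eval x P)
    have n2 := even_nonneg (MvPolynomial.eval x Q)
    rw [ENNReal.ofReal_add (by positivity) (by positivity), ENNReal.ofReal_mul (by positivity),
      ENNReal.ofReal_mul (p := L ^ 2 * t * 3 ^ (4 * q)) (by positivity),
      ENNReal.ofReal_add (by positivity) n2, ENNReal.ofReal_add zero_le_one n1, ENNReal.ofReal_one]
  calc _ ≤ ∫⁻ x, (ENNReal.ofReal (L ^ 2 / t) * ENNReal.ofReal (MvPolynomial.eval x (P - Q) ^ 4) +
        ENNReal.ofReal (L ^ 2 * t * 3 ^ (4 * q)) * (1 +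
          ENNReal.ofReal (MvPolynomial.eval x P ^ (4 * q)) +
            ENNReal.ofReal (MvPolynomial.eval x Q ^ (4 * q)))) ∂(stdGauss d) :=
        lintegral_mono fun x => (ENNReal.ofReal_le_ofReal (hpt x)).trans (split x).le
    _ = ENNReal.ofReal (L ^ 2 / t) *
          ∫⁻ x, ENNReal.ofReal (MvPolynomial.eval x (P - Q) ^ 4) ∂(stdGauss d) +
        ENNReal.ofReal (L ^ 2 * t * 3 ^ (4 * q)) * (1 +
          ∫⁻ x, ENNReal.ofReal (MvPolynomial.eval x P ^ (4 * q)) ∂(stdGauss d) +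
            ∫⁻ x, ENNReal.ofReal (MvPolynomial.eval x Q ^ (4 * q)) ∂(stdGauss d)) := by
        rw [lintegral_add_left (by fun_prop), lintegral_const_mul _ (by fun_prop),
          lintegral_const_mul _ (by fun_prop), lintegral_add_left (by fun_prop),
          lintegral_add_left (by fun_prop)]
        simp
    _ ≤ ENNReal.ofReal (L ^ 2 / t) * ENNReal.ofReal (D * t ^ 2) +
        ENNReal.ofReal (L ^ 2 * t * 3 ^ (4 * q)) *
          (1 + ENNReal.ofReal F + ENNReal.ofReal F) := by
        gcongr
        · exact hmom P hP hPS
        · exact hmom Q hQ hQS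
    _ = ENNReal.ofReal (L ^ 2 * (D + 3 ^ (4 * q) * (1 + F + F)) * t) := by
        rw [← ENNReal.ofReal_one, ← ENNReal.ofReal_add zero_le_one hF0,
          ← ENNReal.ofReal_add (by positivity) hF0, ← ENNReal.ofReal_mul (by positivity),
          ← ENNReal.ofReal_mul (by positivity), ← ENNReal.ofReal_add (by positivity)
          (by positivity)]
        congr 1
        field_simp

/-- A tail bound with the truncation level dictated by the moment growth. -/
theorem exists_tail_bound (k q : ℕ) :
    ∃ A : ℝ, 1 ≤ A ∧ ∀ (d n : ℕ), 1 ≤ n → q ≤ n → ∀ P : MvPolynomial (Fin d) ℝ,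
      P.totalDegree ≤ k → ∀ S : ℝ, 0 < S →
      ∫ x, MvPolynomial.eval x P ^ 2 ∂(stdGauss d) ≤ S ^ 2 →
      ∀ R : ℝ, R = A * S * n ^ k →
      ∫⁻ x, ENNReal.ofReal (if R < |MvPolynomial.eval x P| then
          MvPolynomial.eval x P ^ (2 * q) else 0) ∂(stdGauss d) ≤
        ENNReal.ofReal (R ^ (2 * q) * Real.exp (-(2 * n))) := by
  obtain ⟨A, hA1, hA⟩ := exists_gaussian_moment_bound k
  have he : 1 ≤ Real.exp 1 := Real.one_le_exp zero_le_one
  -- The extra factor `e` in `R` makes the moment ratio `(A₀ S n ^ k / R) ^ (2n)`, with `A₀` the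
  -- moment constant, equal to `exp (-2n)`.
  refine ⟨Real.exp 1 * A, by nlinarith, ?_⟩
  intro d n hn hqn P hP S hS hPS R hR
  have hR0 : 0 < R := by rw [hR]; positivity
  have hpt : ∀ y : ℝ, (if R < |y| then y ^ (2 * q) else 0) ≤
      R ^ (2 * q) / R ^ (2 * n) * y ^ (2 * n) := by
    intro y
    have hy2 : 0 ≤ y ^ (2 * n) := by rw [pow_mul]; positivity
    split_ifs with h
    · have h1 : y ^ (2 * n) = y ^ (2 * q) * (y ^ 2) ^ (n - q) := by
        rw [← pow_mul, ← pow_add]; congr 1; omega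
      have h2 : R ^ (2 * n) = R ^ (2 * q) * (R ^ 2) ^ (n - q) := by
        rw [← pow_mul, ← pow_add]; congr 1; omega
      have h3 : (R ^ 2) ^ (n - q) ≤ (y ^ 2) ^ (n - q) := by
        refine pow_le_pow_left₀ (by positivity) ?_ _
        rw [← sq_abs y]
        exact pow_le_pow_left₀ hR0.le h.le 2
      have h4 : 0 ≤ y ^ (2 * q) := by rw [pow_mul]; positivity
      rw [div_mul_eq_mul_div, le_div_iff₀ (by positivity), h1, h2]
      calc y ^ (2 * q) * (R ^ (2 * q) * (R ^ 2) ^ (n - q))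
          ≤ y ^ (2 * q) * (R ^ (2 * q) * (y ^ 2) ^ (n - q)) := by gcongr
        _ = _ := by ring
    · positivity
  have hnn : 0 ≤ ∫ x, MvPolynomial.eval x P ^ 2 ∂(stdGauss d) :=
    integral_nonneg fun _ => sq_nonneg _
  have hm := measurable_mvPolynomial_eval P
  calc _ ≤ ∫⁻ x, ENNReal.ofReal (R ^ (2 * q) / R ^ (2 * n)) *
        ENNReal.ofReal (MvPolynomial.eval x P ^ (2 * n)) ∂(stdGauss d) :=
        lintegral_mono fun x => by
          rw [← ENNReal.ofReal_mul (by positivity)]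
          exact ENNReal.ofReal_le_ofReal (hpt _)
    _ = ENNReal.ofReal (R ^ (2 * q) / R ^ (2 * n)) *
        ∫⁻ x, ENNReal.ofReal (MvPolynomial.eval x P ^ (2 * n)) ∂(stdGauss d) :=
        lintegral_const_mul _ (by fun_prop)
    _ ≤ ENNReal.ofReal (R ^ (2 * q) / R ^ (2 * n)) *
        ENNReal.ofReal ((A * n ^ k) ^ (2 * n) * (S ^ 2) ^ n) := by
        gcongr
        refine (hA d n hn P hP).trans (ENNReal.ofReal_le_ofReal ?_)
        gcongr
    _ = _ := by
        rw [← ENNReal.ofReal_mul (by positivity)]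
        congr 1
        have e1 : Real.exp (-(2 * n)) = (Real.exp 1 ^ (2 * n))⁻¹ := by
          rw [Real.exp_neg, ← Real.exp_nat_mul]
          simp
        rw [e1, hR]
        field_simp
        ring

/-- Lets the norm of `phat` be bounded before `g` is chosen. -/
theorem exists_abs_meanDeriv_le (q : ℕ) (G : ℝ) :
    ∃ V : ℝ, ∀ g : Polynomial ℝ, g.natDegree ≤ q → (∀ i, |g.coeff i| ≤ G) → |meanDeriv g| ≤ V := by
  refine ⟨∑ i ∈ Finset.range (q + 1), q * G * |∫ z, z ^ i ∂(gaussianReal 0 1)|, fun g hg hG => ?_⟩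
  have hd : g.derivative.natDegree < q + 1 :=
    Nat.lt_succ_of_le ((Polynomial.natDegree_derivative_le g).trans (by omega))
  rw [meanDeriv]
  simp_rw [Polynomial.eval_eq_sum_range' hd]
  rw [integral_finsetSum _ fun i _ => (integrable_pow_gaussianReal i).const_mul _]
  refine (Finset.abs_sum_le_sum_abs _ _).trans (Finset.sum_le_sum fun i _ => ?_)
  rw [integral_const_mul, abs_mul]
  exact mul_le_mul_of_nonneg_right (Polynomial.abs_coeff_derivative_le hg hG i) (abs_nonneg _)

/-- Keeps the estimation error, and with it all second moments, bounded uniformly in `d`. The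
exponent `ε = α / (a + 1)` in `log x ≤ x ^ ε / ε` satisfies `ε a ≤ α`. -/
theorem exists_log_rpow_mul_rpow_neg_le {a α : ℝ} (ha : 0 ≤ a) (hα : 0 < α) :
    ∃ Θ : ℝ, 0 ≤ Θ ∧ ∀ x : ℝ, 1 ≤ x → Real.log x ^ a * x ^ (-α) ≤ Θ := by
  set ε : ℝ := α / (a + 1) with hε
  have hε0 : 0 < ε := by positivity
  refine ⟨(ε⁻¹) ^ a, by positivity, fun x hx => ?_⟩
  have hx0 : 0 < x := by linarith
  have h1 : Real.log x ^ a ≤ (x ^ ε / ε) ^ a :=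
    Real.rpow_le_rpow (Real.log_nonneg hx) (Real.log_le_rpow_div hx0.le hε0) ha
  have h2 : (x ^ ε / ε) ^ a ≤ x ^ α * (ε⁻¹) ^ a := by
    rw [div_eq_mul_inv, Real.mul_rpow (by positivity) (by positivity), ← Real.rpow_mul hx0.le]
    refine mul_le_mul_of_nonneg_right (Real.rpow_le_rpow_of_exponent_le hx ?_) (by positivity)
    rw [hε, div_mul_eq_mul_div, div_le_iff₀ (by positivity)]
    nlinarith
  rw [Real.rpow_neg hx0.le, ← div_eq_mul_inv, div_le_iff₀ (by positivity)]
  linarith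

/-! ### Approximation of a polynomial of a Gaussian polynomial by random ReLU features -/

/-- Where `|P| ≤ R`, the error is exactly the deviation of an empirical mean from its expectation.
Where `|P| > R`, network and `F` are both at most a constant times `|P| ^ q`, which is charged to
the tail moment `T`. -/
theorem exists_event_relu_approx {d q : ℕ} (hq : 1 ≤ q) {s κ M : ℝ} (hs : 0 < s) (hκ : 0 < κ)
    {ρ : ℝ → ℝ} (hρ : IsHeavyTailedDensity s κ M ρ) {F : Polynomial ℝ} (hF : F.natDegree ≤ q)
    {G : ℝ} (hG0 : 0 < G) (hG : ∀ i, |F.coeff i| ≤ G) (P : MvPolynomial (Fin d) ℝ)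
    {R : ℝ} (hR : 1 ≤ R) {m : ℕ} (hm : 1 ≤ m) {η : ℝ} (hη : 0 < η) {T : ℝ}
    (hT : ∫⁻ x, ENNReal.ofReal (if R < |MvPolynomial.eval x P| then
        MvPolynomial.eval x P ^ (2 * q) else 0) ∂(stdGauss d) ≤ ENNReal.ofReal T) {Z : ℝ}
    (hZ : Z = 4 * (q + 1) ^ 3 * G * κ⁻¹ * 3 ^ s * R ^ s * R ^ (q - 1)) :
    ∃ E : Set (Fin m → ℝ × ℝ), MeasurableSet E ∧
      ENNReal.ofReal (1 - η) ≤ featureLaw m ρ E ∧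
      ∀ w ∈ E, ∃ c : Fin m → ℝ, (∀ i, |c i| ≤ Z / m) ∧
        ∫⁻ x, ENNReal.ofReal ((∑ i, c i * relu ((w i).1 * MvPolynomial.eval x P + (w i).2) -
          F.eval (MvPolynomial.eval x P)) ^ 2) ∂(stdGauss d) ≤
        ENNReal.ofReal ((Z * (3 * R)) ^ 2 / (m * η)) +
          ENNReal.ofReal ((3 * Z + (q + 1) * G) ^ 2) * ENNReal.ofReal T := by
  have := hρ.isProb
  have hR0 : 0 < R := by linarith
  have hm0 : (0 : ℝ) < m := by exact_mod_cast hm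
  have hZ0 : 0 < Z := by rw [hZ]; positivity
  obtain ⟨W, hWm, hWb, hWs, hWf⟩ := exists_relu_representation hq hs hκ hρ hF hG hR
  rw [← hZ] at hWb
  have hPm := measurable_mvPolynomial_eval P
  -- Features are set to zero on the tail because the Monte Carlo bound needs bounded functions; the
  -- actual network is not truncated.
  set φ : ℝ × ℝ → (Fin d → ℝ) → ℝ := fun v x => if R < |MvPolynomial.eval x P| then 0 else
    W v * relu (v.1 * MvPolynomial.eval x P + v.2) with hφ
  have hfeat : ∀ v y, |W v * relu (v.1 * y + v.2)| ≤ Z * (|y| + 2 * R) := by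
    intro v y
    by_cases hv : W v = 0
    · rw [hv, zero_mul, abs_zero]
      positivity
    obtain ⟨h1, h2⟩ := hWs v hv
    rw [abs_mul]
    refine mul_le_mul (hWb v) ((abs_relu_le _).trans ((abs_add_le _ _).trans ?_)) (abs_nonneg _)
      hZ0.le
    rw [abs_mul, h1]
    linarith
  have hφm : Measurable (Function.uncurry φ) := by
    refine Measurable.ite (measurableSet_lt measurable_const (hPm.comp measurable_snd).abs)
      measurable_const ((hWm.comp measurable_fst).mul (continuous_relu.measurable.comp ?_))
    exact ((measurable_fst.comp measurable_fst).mul (hPm.comp measurable_snd)).add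
      (measurable_snd.comp measurable_fst)
  have hφb : ∀ v x, |φ v x| ≤ Z * (3 * R) := by
    intro v x
    simp only [hφ]
    split_ifs with h
    · rw [abs_zero]; positivity
    · refine (hfeat _ _).trans ?_
      gcongr
      linarith
  obtain ⟨E, hEm, hEp, hE⟩ := exists_event_empirical_mean_close (signLaw.prod (densityLaw ρ))
    (stdGauss d) hφm (by positivity : 0 < Z * (3 * R)) hφb hm hη
  refine ⟨E, hEm, hEp, fun w hw => ⟨fun i => W (w i) / m, fun i => ?_, ?_⟩⟩
  · rw [abs_div, Nat.abs_cast]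
    exact div_le_div_of_nonneg_right (hWb _) hm0.le
  set Φ : (Fin d → ℝ) → ℝ := fun x =>
    (∑ i, φ (w i) x) / m - ∫ v, φ v x ∂(signLaw.prod (densityLaw ρ)) with hΦ
  set τ : (Fin d → ℝ) → ℝ := fun x =>
    if R < |MvPolynomial.eval x P| then MvPolynomial.eval x P ^ (2 * q) else 0 with hτ
  have hτm : Measurable τ := Measurable.ite (measurableSet_lt measurable_const hPm.abs)
    (hPm.pow_const _) measurable_const
  have hτ0 : ∀ x, 0 ≤ τ x := fun x => by
    simp only [hτ]
    split_ifs
    · rw [pow_mul]; positivity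
    · exact le_rfl
  have hpt : ∀ x, (∑ i, W (w i) / m * relu ((w i).1 * MvPolynomial.eval x P + (w i).2) -
      F.eval (MvPolynomial.eval x P)) ^ 2 ≤ Φ x ^ 2 + (3 * Z + (q + 1) * G) ^ 2 * τ x := by
    intro x
    set y := MvPolynomial.eval x P with hy
    have hsum : ∑ i, W (w i) / m * relu ((w i).1 * y + (w i).2) =
        (∑ i, W (w i) * relu ((w i).1 * y + (w i).2)) / m := by
      rw [Finset.sum_div]
      exact Finset.sum_congr rfl fun i _ => by ring
    by_cases h : R < |y|
    · have hy1 : 1 ≤ |y| := by linarith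
      have hq1 : |y| ≤ |y| ^ q := le_self_pow₀ hy1 (by omega)
      have h1 : |(∑ i, W (w i) * relu ((w i).1 * y + (w i).2)) / m| ≤ 3 * Z * |y| ^ q := by
        rw [abs_div, Nat.abs_cast, div_le_iff₀ hm0]
        refine (Finset.abs_sum_le_sum_abs _ _).trans ?_
        refine (Finset.sum_le_card_nsmul _ _ (3 * Z * |y| ^ q) fun i _ => ?_).trans
          (le_of_eq ?_)
        · refine (hfeat _ _).trans ?_
          calc Z * (|y| + 2 * R) ≤ Z * (3 * |y| ^ q) := by gcongr; linarith
            _ = 3 * Z * |y| ^ q := by ring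
        · simp
          ring
      have h2 := Polynomial.abs_eval_le_of_coeff hF hG hy1 le_rfl
      have hτx : τ x = (|y| ^ q) ^ 2 := by
        simp only [hτ, ← hy, if_pos h]
        rw [← abs_pow, sq_abs, ← pow_mul, mul_comm]
      rw [hτx, ← mul_pow, hsum, ← sq_abs]
      have h3 : |(∑ i, W (w i) * relu ((w i).1 * y + (w i).2)) / m - F.eval y| ≤
          (3 * Z + (q + 1) * G) * |y| ^ q := by
        refine (abs_sub _ _).trans ?_
        linarith
      have h4 := pow_le_pow_left₀ (abs_nonneg _) h3 2
      linarith [sq_nonneg (Φ x)]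
    · have hΦx : Φ x = (∑ i, W (w i) * relu ((w i).1 * y + (w i).2)) / m - F.eval y := by
        simp only [hΦ, hφ, ← hy, if_neg h]
        rw [hWf y (not_lt.1 h)]
      rw [hΦx, hsum]
      have := hτ0 x
      nlinarith [mul_nonneg (sq_nonneg (3 * Z + (q + 1) * G)) this]
  calc _ ≤ ∫⁻ x, (ENNReal.ofReal (Φ x ^ 2) +
        ENNReal.ofReal ((3 * Z + (q + 1) * G) ^ 2) * ENNReal.ofReal (τ x)) ∂(stdGauss d) :=
        lintegral_mono fun x => by
          rw [← ENNReal.ofReal_mul (sq_nonneg _), ← ENNReal.ofReal_add (sq_nonneg _)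
            (mul_nonneg (sq_nonneg _) (hτ0 x))]
          exact ENNReal.ofReal_le_ofReal (hpt x)
    _ = ∫⁻ x, ENNReal.ofReal (Φ x ^ 2) ∂(stdGauss d) +
        ENNReal.ofReal ((3 * Z + (q + 1) * G) ^ 2) *
          ∫⁻ x, ENNReal.ofReal (τ x) ∂(stdGauss d) := by
        rw [lintegral_add_right _ (hτm.ennreal_ofReal.const_mul _),
          lintegral_const_mul _ hτm.ennreal_ofReal]
    _ ≤ _ := add_le_add (hE w hw) (mul_le_mul_right hT _)

/-! ### Rescaling by the mean derivative, and the choice of parameters. -/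

theorem integral_sq_eval_C_mul {d : ℕ} (a : ℝ) (P : MvPolynomial (Fin d) ℝ) :
    ∫ x, MvPolynomial.eval x (MvPolynomial.C a * P) ^ 2 ∂(stdGauss d) =
      a ^ 2 * ∫ x, MvPolynomial.eval x P ^ 2 ∂(stdGauss d) := by
  rw [← integral_const_mul]
  simp [mul_pow]

theorem integral_sq_eval_add_le {d : ℕ} (P Q : MvPolynomial (Fin d) ℝ) :
    ∫ x, MvPolynomial.eval x (P + Q) ^ 2 ∂(stdGauss d) ≤
      2 * ∫ x, MvPolynomial.eval x P ^ 2 ∂(stdGauss d) +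
        2 * ∫ x, MvPolynomial.eval x Q ^ 2 ∂(stdGauss d) := by
  have hi : ∀ P : MvPolynomial (Fin d) ℝ,
      Integrable (fun x => MvPolynomial.eval x P ^ 2) (stdGauss d) := fun P =>
    (integrable_eval_stdGauss (P ^ 2)).congr (ae_of_all _ fun x => by simp)
  rw [← integral_const_mul, ← integral_const_mul,
    ← integral_add ((hi P).const_mul 2) ((hi Q).const_mul 2)]
  refine integral_mono (hi _) (((hi P).const_mul 2).add ((hi Q).const_mul 2)) fun x => ?_
  simp only [map_add]
  nlinarith [sq_nonneg (MvPolynomial.eval x P - MvPolynomial.eval x Q)]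

/-- The polynomial `z ↦ g (a z) - z`. -/
noncomputable def rescaledResidual (g : Polynomial ℝ) (a : ℝ) : Polynomial ℝ :=
  g.comp (Polynomial.C a * Polynomial.X) - Polynomial.X

theorem eval_rescaledResidual (g : Polynomial ℝ) (a z : ℝ) :
    (rescaledResidual g a).eval z = g.eval (a * z) - z := by
  simp [rescaledResidual]

theorem natDegree_rescaledResidual_le {g : Polynomial ℝ} {q : ℕ} (hq : 1 ≤ q)
    (hg : g.natDegree ≤ q) (a : ℝ) : (rescaledResidual g a).natDegree ≤ q := by
  refine (Polynomial.natDegree_sub_le _ _).trans (max_le ?_ (by simpa using hq))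
  refine Polynomial.natDegree_comp_le.trans ?_
  calc g.natDegree * (Polynomial.C a * Polynomial.X).natDegree ≤ g.natDegree * 1 :=
        Nat.mul_le_mul_left _ ((Polynomial.natDegree_C_mul_le _ _).trans Polynomial.natDegree_X.le)
    _ ≤ q := by omega

theorem abs_coeff_rescaledResidual_le {g : Polynomial ℝ} {q : ℕ} (hg : g.natDegree ≤ q) {G : ℝ}
    (hG : ∀ i, |g.coeff i| ≤ G) {a b : ℝ} (hab : |a| ≤ b) (i : ℕ) :
    |(rescaledResidual g a).coeff i| ≤ G * (1 + b) ^ q + 1 := by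
  have hG0 : 0 ≤ G := (abs_nonneg _).trans (hG 0)
  have hb : 0 ≤ b := (abs_nonneg a).trans hab
  rw [rescaledResidual, Polynomial.coeff_sub, Polynomial.comp_C_mul_X_coeff]
  refine (abs_sub _ _).trans (add_le_add ?_ ?_)
  · by_cases hi : i ≤ q
    · rw [abs_mul, abs_pow]
      refine mul_le_mul (hG i) ?_ (by positivity) hG0
      exact (pow_le_pow_left₀ (abs_nonneg _) (by linarith) i).trans
        (pow_le_pow_right₀ (by linarith) hi)
    · rw [Polynomial.coeff_eq_zero_of_natDegree_lt (by omega)]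
      simp
      positivity
  · rw [Polynomial.coeff_X]
    split_ifs <;> simp

/-- As `d ^ α > 1`, rounding cannot give `m = 0`, and then `d ^ α < m + 1 ≤ 2m`. -/
theorem width_bounds {d : ℕ} (hd : 2 ≤ d) {α : ℝ} (hα : 0 < α) {m : ℕ}
    (hm : |(m : ℝ) - (d : ℝ) ^ α| < 1) : 1 ≤ m ∧ (m : ℝ)⁻¹ ≤ 2 * (d : ℝ) ^ (-α) := by
  have hd1 : (1 : ℝ) < d := by exact_mod_cast (by omega : 1 < d)
  have hdα : 1 < (d : ℝ) ^ α := Real.one_lt_rpow hd1 hα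
  obtain ⟨h1, h2⟩ := abs_lt.1 hm
  have hm1 : 1 ≤ m := by
    have : (0 : ℝ) < m := by linarith
    exact_mod_cast this
  have hm1' : (1 : ℝ) ≤ m := by exact_mod_cast hm1
  refine ⟨hm1, ?_⟩
  rw [Real.rpow_neg (by linarith), ← div_eq_mul_inv, inv_eq_one_div,
    div_le_div_iff₀ (by linarith) (by linarith)]
  linarith

/-- The truncation level `A n ^ k` with `n = q + ⌈log d⌉` is of order `(log d) ^ k`, and its powers
are beaten by `exp (-n)`. -/
theorem truncation_bounds (k q : ℕ) {A s α : ℝ} (hA : 1 ≤ A) (hs : 0 < s) (hα : α ≤ 1) :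
    ∃ C : ℝ, 0 < C ∧ ∀ d : ℕ, 2 ≤ d → ∃ n : ℕ, 1 ≤ n ∧ q ≤ n ∧ 1 ≤ A * n ^ k ∧
      (A * n ^ k) ^ s * (A * n ^ k) ^ q ≤ C * Real.log d ^ ((k : ℝ) * (s + q)) ∧
      (A * n ^ k) ^ (2 * q) * Real.exp (-(2 * n)) ≤ C * (d : ℝ) ^ (-α) := by
  have hl2 : 0 < Real.log 2 := Real.log_pos one_lt_two
  -- Chosen so that `n ≤ q + 1 + log d ≤ c log d`, using `log d ≥ log 2`.
  set c : ℝ := (q + 1) / Real.log 2 + 1 with hc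
  have hc0 : 0 < c := by positivity
  refine ⟨(A * c ^ k) ^ (s + q) + A ^ (2 * q) * (2 * k * q).factorial, by positivity,
    fun d hd => ?_⟩
  have hd2 : (2 : ℝ) ≤ d := by exact_mod_cast hd
  have hd0 : (0 : ℝ) < d := by linarith
  have hl : Real.log 2 ≤ Real.log d := Real.log_le_log two_pos hd2
  set l := Real.log d with hldef
  have hl0 : 0 < l := by linarith
  have hceil : 1 ≤ ⌈l⌉₊ := Nat.one_le_ceil_iff.2 hl0
  set n : ℕ := q + ⌈l⌉₊ with hn
  have hn1 : 1 ≤ n := by omega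
  have hn1' : (1 : ℝ) ≤ n := by exact_mod_cast hn1
  have hln : l ≤ n := (Nat.le_ceil l).trans (by exact_mod_cast (by omega : ⌈l⌉₊ ≤ n))
  have hncl : (n : ℝ) ≤ c * l := by
    have h1 : (⌈l⌉₊ : ℝ) ≤ l + 1 := (Nat.ceil_lt_add_one hl0.le).le
    have h2 : (q + 1 : ℝ) ≤ (q + 1) / Real.log 2 * l := by
      rw [div_mul_eq_mul_div, le_div_iff₀ hl2]
      gcongr
    rw [hn, hc]
    push_cast
    linarith
  have hR1 : 1 ≤ A * (n : ℝ) ^ k := one_le_mul_of_one_le_of_one_le hA (one_le_pow₀ hn1')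
  have hR0 : 0 < A * (n : ℝ) ^ k := by linarith
  refine ⟨n, hn1, by omega, hR1, ?_, ?_⟩
  · rw [← Real.rpow_natCast (A * (n : ℝ) ^ k) q, ← Real.rpow_add hR0]
    calc (A * (n : ℝ) ^ k) ^ (s + q) ≤ (A * c ^ k * l ^ k) ^ (s + q) := by
          refine Real.rpow_le_rpow hR0.le ?_ (by positivity)
          rw [mul_assoc, ← mul_pow]
          gcongr
      _ = (A * c ^ k) ^ (s + q) * l ^ ((k : ℝ) * (s + q)) := by
          rw [Real.mul_rpow (by positivity) (by positivity), ← Real.rpow_natCast l k,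
            ← Real.rpow_mul hl0.le]
      _ ≤ _ := by
          gcongr
          exact le_add_of_nonneg_right (by positivity)
  -- One factor `exp (-n)` absorbs the powers of `n`; the other gives `d ^ (-α)`, since `n ≥ log d ≥
  -- α log d`.
  · have h1 : (n : ℝ) ^ (2 * k * q) ≤ Real.exp n * (2 * k * q).factorial := by
      have := Real.pow_div_factorial_le_exp (n : ℝ) (by positivity) (2 * k * q)
      rwa [div_le_iff₀ (by positivity)] at this
    have h2 : Real.exp (-n) ≤ (d : ℝ) ^ (-α) := by
      rw [Real.rpow_def_of_pos hd0, ← hldef]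
      refine Real.exp_le_exp.2 ?_
      nlinarith
    have h3 : Real.exp (-(2 * n)) = Real.exp (-n) * Real.exp (-n) := by
      rw [← Real.exp_add]
      ring_nf
    have h4 : Real.exp n * Real.exp (-n) = 1 := by rw [← Real.exp_add]; simp
    calc (A * (n : ℝ) ^ k) ^ (2 * q) * Real.exp (-(2 * n))
        = A ^ (2 * q) * (n : ℝ) ^ (2 * k * q) * (Real.exp (-n) * Real.exp (-n)) := by
          rw [h3, mul_pow, ← pow_mul]
          ring_nf
      _ ≤ A ^ (2 * q) * (Real.exp n * (2 * k * q).factorial) * (Real.exp (-n) * Real.exp (-n)) := by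
          gcongr
      _ = A ^ (2 * q) * (2 * k * q).factorial * (Real.exp n * Real.exp (-n)) * Real.exp (-n) := by
          ring
      _ ≤ A ^ (2 * q) * (2 * k * q).factorial * (d : ℝ) ^ (-α) := by
          rw [h4, mul_one]
          gcongr
      _ ≤ _ := by
          gcongr
          exact le_add_of_nonneg_left (by positivity)

theorem meanDeriv_eq_zero {g : Polynomial ℝ} (hg : g.natDegree ≤ 0) : meanDeriv g = 0 := by
  simp [meanDeriv, Polynomial.derivative_of_natDegree_zero (Nat.le_zero.1 hg)]

/-- The rescaled estimate `v⁻¹ p̂` is close to `p`, and all polynomials involved have bounded norm. -/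
theorem rescaled_estimate_bounds {d : ℕ} {v V c₀ τ : ℝ} (hc₀ : 0 < c₀) (hv : c₀ ≤ |v|)
    (hvV : |v| ≤ V) (p P : MvPolynomial (Fin d) ℝ)
    (hp : ∫ x, MvPolynomial.eval x p ^ 2 ∂(stdGauss d) = 1)
    (hP : ∫ x, MvPolynomial.eval x (P - MvPolynomial.C v * p) ^ 2 ∂(stdGauss d) ≤ τ) :
    ∫ x, MvPolynomial.eval x P ^ 2 ∂(stdGauss d) ≤ 2 * V ^ 2 + 2 * τ ∧
    ∫ x, MvPolynomial.eval x (MvPolynomial.C v⁻¹ * P) ^ 2 ∂(stdGauss d) ≤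
      c₀⁻¹ ^ 2 * (2 * V ^ 2 + 2 * τ) ∧
    ∫ x, MvPolynomial.eval x (MvPolynomial.C v⁻¹ * P - p) ^ 2 ∂(stdGauss d) ≤ c₀⁻¹ ^ 2 * τ := by
  have hv0 : v ≠ 0 := by
    rintro rfl
    rw [abs_zero] at hv
    linarith
  have hinv : v⁻¹ ^ 2 ≤ c₀⁻¹ ^ 2 := by
    rw [← sq_abs, abs_inv]
    exact pow_le_pow_left₀ (by positivity) (inv_anti₀ hc₀ hv) 2
  have h1 : ∫ x, MvPolynomial.eval x P ^ 2 ∂(stdGauss d) ≤ 2 * V ^ 2 + 2 * τ := by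
    have h := integral_sq_eval_add_le (MvPolynomial.C v * p) (P - MvPolynomial.C v * p)
    rw [add_sub_cancel, integral_sq_eval_C_mul, hp] at h
    have hV : v ^ 2 ≤ V ^ 2 := by
      rw [← sq_abs]
      exact pow_le_pow_left₀ (abs_nonneg _) hvV 2
    linarith
  refine ⟨h1, ?_, ?_⟩
  · rw [integral_sq_eval_C_mul]
    exact mul_le_mul hinv h1 (integral_nonneg fun _ => sq_nonneg _) (by positivity)
  · have e : MvPolynomial.C v⁻¹ * P - p = MvPolynomial.C v⁻¹ * (P - MvPolynomial.C v * p) := by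
      rw [mul_sub, ← mul_assoc, ← MvPolynomial.C_mul, inv_mul_cancel₀ hv0, MvPolynomial.C_1, one_mul]
    rw [e, integral_sq_eval_C_mul]
    exact mul_le_mul hinv hP (integral_nonneg fun _ => sq_nonneg _) (by positivity)

theorem lintegral_ofReal_sq_add_le {X : Type*} [MeasurableSpace X] (μ : Measure X) (f : X → ℝ)
    {g : X → ℝ} (hg : Measurable g) :
    ∫⁻ y, ENNReal.ofReal ((f y + g y) ^ 2) ∂μ ≤
      ENNReal.ofReal 2 * ∫⁻ y, ENNReal.ofReal (f y ^ 2) ∂μ +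
        ENNReal.ofReal 2 * ∫⁻ y, ENNReal.ofReal (g y ^ 2) ∂μ := by
  rw [← lintegral_const_mul' _ _ ENNReal.ofReal_ne_top,
    ← lintegral_const_mul' _ _ ENNReal.ofReal_ne_top,
    ← lintegral_add_right _ ((hg.pow_const 2).ennreal_ofReal.const_mul _)]
  refine lintegral_mono fun y => ?_
  rw [← ENNReal.ofReal_mul two_pos.le, ← ENNReal.ofReal_mul two_pos.le,
    ← ENNReal.ofReal_add (by positivity) (by positivity)]
  refine ENNReal.ofReal_le_ofReal ?_
  nlinarith [sq_nonneg (f y - g y)]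

/-- The sampling, truncation and estimation errors add up to the claimed rate. -/
theorem error_budget_le {m η Z₀ H₀ C₀ D T x γ₁ γ₂ B C U Γ Λ : ℝ} (hm : 0 < m) (hη : 0 < η)
    (hZ₀ : 0 ≤ Z₀) (hH₀ : 0 ≤ H₀) (hC₀ : 0 ≤ C₀) (hD : 0 ≤ D) (hT : 0 ≤ T) (hx : 0 ≤ x)
    (hγ₁ : 0 < γ₁) (hγ₂ : 0 < γ₂) (hB : 0 ≤ B) (hU : 0 ≤ U) (hUD : U ≤ H₀ * D)
    (hDΛ : D ≤ C₀ * Λ) (hminv : m⁻¹ ≤ 2 * x) (hTx : T ≤ C₀ * x) (hΓ : γ₁ ≤ Γ) (hΛ : γ₂ ≤ Λ)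
    (hC : 0 ≤ C) :
    2 * ((3 * Z₀ * D) ^ 2 / (m * η) + U ^ 2 * T) + B * Γ * x ≤
      (C + (36 * (Z₀ * C₀) ^ 2 / η + 2 * (H₀ * C₀) ^ 2 * C₀) / γ₁ + B / γ₂ ^ 2) *
        (Γ * Λ ^ 2) * x := by
  have hΓ0 : 0 < Γ := by linarith
  have hΛ0 : 0 < Λ := by linarith
  set B₁ : ℝ := 36 * (Z₀ * C₀) ^ 2 / η + 2 * (H₀ * C₀) ^ 2 * C₀ with hB₁
  have hB₁0 : 0 ≤ B₁ := by positivity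
  have a1 : (3 * Z₀ * D) ^ 2 / (m * η) ≤ (3 * Z₀ * (C₀ * Λ)) ^ 2 * (2 * x) / η := by
    rw [div_mul_eq_div_div, div_eq_mul_inv _ m]
    gcongr
  have a2 : U ^ 2 * T ≤ (H₀ * (C₀ * Λ)) ^ 2 * (C₀ * x) := by
    gcongr
    exact hUD.trans (by gcongr)
  -- Sampling and truncation carry only `Λ ^ 2`, estimation only `Γ`; the lower bounds `γ₁` and `γ₂`
  -- pad each to `Γ * Λ ^ 2`.
  have a3 : B₁ * Λ ^ 2 * x ≤ B₁ / γ₁ * (Γ * Λ ^ 2) * x := by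
    have : B₁ ≤ B₁ / γ₁ * Γ := by
      rw [div_mul_eq_mul_div, le_div_iff₀ hγ₁]
      gcongr
    calc B₁ * Λ ^ 2 * x ≤ (B₁ / γ₁ * Γ) * Λ ^ 2 * x := by gcongr
      _ = _ := by ring
  have a4 : B * Γ * x ≤ B / γ₂ ^ 2 * (Γ * Λ ^ 2) * x := by
    have : B ≤ B / γ₂ ^ 2 * Λ ^ 2 := by
      rw [div_mul_eq_mul_div, le_div_iff₀ (by positivity)]
      gcongr
    calc B * Γ * x ≤ (B / γ₂ ^ 2 * Λ ^ 2) * Γ * x := by gcongr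
      _ = _ := by ring
  have a5 : 0 ≤ C * (Γ * Λ ^ 2) * x := by positivity
  calc _ ≤ 2 * ((3 * Z₀ * (C₀ * Λ)) ^ 2 * (2 * x) / η + (H₀ * (C₀ * Λ)) ^ 2 * (C₀ * x)) +
        B * Γ * x := by gcongr
    _ = B₁ * Λ ^ 2 * x + B * Γ * x := by rw [hB₁]; ring
    _ ≤ _ := by linarith

/-! ### Assembly of the three errors. -/

set_option maxHeartbeats 800000 in
theorem lemma4p4
    -- degrees, tail exponent, width exponent, failure probability
    (k q : ℕ) (hk : 2 ≤ k) (s : ℝ) (hs : 0 < s)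
    (α : ℝ) (hα : α ∈ Set.Ioo (0 : ℝ) 1) (δ : ℝ) (hδ : δ ∈ Set.Ioo (0 : ℝ) 1)
    -- the implied constants of the assumptions
    (G c₀ κ M K : ℝ) (hc₀ : 0 < c₀) (hκ : 0 < κ) :
    ∃ C : ℝ, 0 < C ∧
      ∀ (d : ℕ), 2 ≤ d →
      ∀ (g : Polynomial ℝ), g.natDegree ≤ q → (∀ i, |g.coeff i| ≤ G) → c₀ ≤ |meanDeriv g| →
      ∀ (p : MvPolynomial (Fin d) ℝ), p.totalDegree ≤ k →
        gaussNormSq (fun x => MvPolynomial.eval x p) = 1 →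
      ∀ (phat : MvPolynomial (Fin d) ℝ), phat.totalDegree ≤ k →
        gaussNormSq (fun x => MvPolynomial.eval x phat - meanDeriv g * MvPolynomial.eval x p) ≤
          ENNReal.ofReal
            (K * Real.log d ^ ((k * q : ℝ) / 2) * (d : ℝ) ^ (-α)) →
      ∀ (ρ : ℝ → ℝ), IsHeavyTailedDensity s κ M ρ →
      -- the width is `d ^ α`, rounded to an integer
      ∀ (m : ℕ), |(m : ℝ) - (d : ℝ) ^ α| < 1 →
        ∃ E : Set (Fin m → ℝ × ℝ), MeasurableSet E ∧
          ENNReal.ofReal (1 - δ / 4) ≤ featureLaw m ρ E ∧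
          ∀ w ∈ E, ∃ c : Fin m → ℝ,
            (∀ i, |c i| ≤ C * Real.log d ^ ((k : ℝ) * (s + q)) * (d : ℝ) ^ (-α)) ∧
            gaussNormSq (fun x => residualNet w c (MvPolynomial.eval x phat) -
                g.eval (MvPolynomial.eval x p)) ≤
              ENNReal.ofReal
                (C * Real.log d ^ ((k * q : ℝ) / 2 + 2 * k * (s + q)) * (d : ℝ) ^ (-α)) := by
  -- For `q = 0` the polynomial `g` is constant, which contradicts `c₀ ≤ |meanDeriv g|`.
  rcases Nat.eq_zero_or_pos q with hq0 | hq
  · subst hq0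
    refine ⟨1, one_pos, fun d _ g hg _ hv => ?_⟩
    rw [meanDeriv_eq_zero hg, abs_zero] at hv
    exact absurd hv (not_le.2 hc₀)
  obtain ⟨hα0, hα1⟩ := hα
  obtain ⟨hδ0, -⟩ := hδ
  have hq1 : 1 ≤ q := hq
  set η : ℝ := δ / 4 with hη
  have hη0 : 0 < η := by positivity
  set K' : ℝ := |K| + 1 with hK'
  have hK'0 : 0 < K' := by positivity
  have hl2 : 0 < Real.log 2 := Real.log_pos one_lt_two
  obtain ⟨V, hV⟩ := exists_abs_meanDeriv_le q G
  obtain ⟨Θ, hΘ0, hΘ⟩ := exists_log_rpow_mul_rpow_neg_le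
    (by positivity : (0 : ℝ) ≤ (k * q : ℝ) / 2) hα0
  set X : ℝ := 2 * V ^ 2 + 2 * (K' * Θ) with hX
  have hX0 : 0 ≤ X := by positivity
  -- A single radius bounding the `L²` norms of `phat`, of `v⁻¹ phat` and of `p`.
  set S : ℝ := (1 + c₀⁻¹) * (1 + X) with hS
  have hci : 0 < c₀⁻¹ := inv_pos.2 hc₀
  have hS1 : 1 ≤ S := by nlinarith [mul_nonneg hci.le hX0]
  have hXsq : X ≤ (1 + X) ^ 2 := by nlinarith
  have hSX : X ≤ S ^ 2 := by
    rw [hS, mul_pow]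
    exact hXsq.trans (le_mul_of_one_le_left (by positivity) (one_le_pow₀ (by linarith)))
  have hScX : c₀⁻¹ ^ 2 * X ≤ S ^ 2 := by
    rw [hS, mul_pow]
    exact mul_le_mul (pow_le_pow_left₀ hci.le (by linarith) 2) hXsq hX0 (by positivity)
  obtain ⟨A, hA1, hA⟩ := exists_tail_bound k q
  have hAS1 : 1 ≤ A * S := one_le_mul_of_one_le_of_one_le hA1 hS1
  obtain ⟨C₀, hC₀, htr⟩ := truncation_bounds k q hAS1 hs hα1.le
  obtain ⟨C₁, hC₁, hcomp⟩ := exists_composition_lipschitz k q hq1 G S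
  -- Coefficient bound for the rescaled residual; `|G|` because `G ≥ 0` is known only once a `g` is
  -- given.
  set G' : ℝ := |G| * (1 + c₀⁻¹) ^ q + 1 with hG'
  have hG'0 : 0 < G' := by positivity
  set Z₀ : ℝ := 4 * (q + 1) ^ 3 * G' * κ⁻¹ * 3 ^ s with hZ₀
  have hZ₀0 : 0 < Z₀ := by positivity
  set H₀ : ℝ := 3 * Z₀ + (q + 1) * G' with hH₀
  have hH₀0 : 0 < H₀ := by positivity
  set γ₁ : ℝ := Real.log 2 ^ ((k * q : ℝ) / 2) with hγ₁
  set γ₂ : ℝ := Real.log 2 ^ ((k : ℝ) * (s + q)) with hγ₂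
  have hγ₁0 : 0 < γ₁ := by positivity
  have hγ₂0 : 0 < γ₂ := by positivity
  set B₁ : ℝ := 36 * (Z₀ * C₀) ^ 2 / η + 2 * (H₀ * C₀) ^ 2 * C₀ with hB₁
  set B₂ : ℝ := 2 * C₁ * (c₀⁻¹ ^ 2 * K') with hB₂
  have hB₁0 : 0 < B₁ := by positivity
  have hB₂0 : 0 ≤ B₂ := by positivity
  refine ⟨2 * Z₀ * C₀ + B₁ / γ₁ + B₂ / γ₂ ^ 2, by positivity, ?_⟩
  intro d hd g hg hgG hv p hp hpn P hP hPp ρ hρ m hm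
  have hd2 : (2 : ℝ) ≤ d := by exact_mod_cast hd
  have hd0 : (0 : ℝ) < d := by linarith
  have hl : Real.log 2 ≤ Real.log d := Real.log_le_log two_pos hd2
  set l := Real.log d with hldef
  have hl0 : 0 < l := by linarith
  set x : ℝ := (d : ℝ) ^ (-α) with hx
  have hx0 : 0 < x := by positivity
  set Γ : ℝ := l ^ ((k * q : ℝ) / 2) with hΓ
  have hΓ0 : 0 < Γ := by positivity
  have hΓ1 : γ₁ ≤ Γ := Real.rpow_le_rpow hl2.le hl (by positivity)
  set Λ : ℝ := l ^ ((k : ℝ) * (s + q)) with hΛ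
  have hΛ0 : 0 < Λ := by positivity
  have hΛ1 : γ₂ ≤ Λ := Real.rpow_le_rpow hl2.le hl (by positivity)
  have hexp : l ^ ((k * q : ℝ) / 2 + 2 * k * (s + q)) = Γ * Λ ^ 2 := by
    have h2 : Λ ^ 2 = l ^ (2 * k * (s + q)) := by
      rw [sq, hΛ, ← Real.rpow_add hl0]
      congr 1
      ring
    rw [h2, Real.rpow_add hl0]
  obtain ⟨hm1, hminv⟩ := width_bounds hd hα0 hm
  have hm0 : (0 : ℝ) < m := by exact_mod_cast hm1
  set v := meanDeriv g with hvdef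
  have hvV : |v| ≤ V := hV g hg hgG
  have hG0 : 0 ≤ G := (abs_nonneg _).trans (hgG 0)
  -- second moments of `p`, `P` and their difference
  set τ : ℝ := K' * Γ * x with hτ
  have hτ0 : 0 < τ := by positivity
  have hτΘ : τ ≤ K' * Θ := by
    rw [hτ, mul_assoc]
    exact mul_le_mul_of_nonneg_left (hΘ d (by linarith)) hK'0.le
  have hp1 : ∫ y, MvPolynomial.eval y p ^ 2 ∂(stdGauss d) = 1 := by
    rw [gaussNormSq_mvPolynomial, ENNReal.ofReal_eq_one] at hpn
    exact hpn
  have hdiff : ∫ y, MvPolynomial.eval y (P - MvPolynomial.C v * p) ^ 2 ∂(stdGauss d) ≤ τ := by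
    have e : (fun y => MvPolynomial.eval y P - v * MvPolynomial.eval y p) =
        fun y => MvPolynomial.eval y (P - MvPolynomial.C v * p) := by
      ext y
      simp
    rw [e, gaussNormSq_mvPolynomial] at hPp
    refine (ENNReal.ofReal_le_ofReal_iff hτ0.le).1 (hPp.trans (ENNReal.ofReal_le_ofReal ?_))
    rw [hτ]
    gcongr
    linarith [le_abs_self K]
  obtain ⟨hPV, hP2V, hP2p⟩ := rescaled_estimate_bounds hc₀ hv hvV p P hp1 hdiff
  have hPS : ∫ y, MvPolynomial.eval y P ^ 2 ∂(stdGauss d) ≤ S ^ 2 := by linarith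
  have hP2S : ∫ y, MvPolynomial.eval y (MvPolynomial.C v⁻¹ * P) ^ 2 ∂(stdGauss d) ≤ S ^ 2 := by
    refine hP2V.trans (le_trans ?_ hScX)
    gcongr
    linarith
  have hP2deg : (MvPolynomial.C v⁻¹ * P).totalDegree ≤ k := by
    refine (MvPolynomial.totalDegree_mul _ _).trans ?_
    rw [MvPolynomial.totalDegree_C, zero_add]
    exact hP
  have hcompose := hcomp d g hg hgG (MvPolynomial.C v⁻¹ * P) p hP2deg hp hP2S
    (hp1.le.trans (one_le_pow₀ hS1)) (c₀⁻¹ ^ 2 * τ) (by positivity) hP2p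
  -- truncation level
  obtain ⟨n, hn1, hqn, hR1, hRD, hRtail⟩ := htr d hd
  set R : ℝ := A * S * n ^ k with hR
  have hR0 : 0 < R := by linarith
  have htail := hA d n hn1 hqn P hP S (by linarith) hPS R hR
  set T : ℝ := R ^ (2 * q) * Real.exp (-(2 * n)) with hT
  have hT0 : 0 ≤ T := by positivity
  set D : ℝ := R ^ s * R ^ q with hD
  have hRs1 : 1 ≤ R ^ s := Real.one_le_rpow hR1 hs.le
  have hD1 : 1 ≤ D := one_le_mul_of_one_le_of_one_le hRs1 (one_le_pow₀ hR1)
  -- the residual polynomial and the random features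
  have hFG : ∀ i, |(rescaledResidual g v⁻¹).coeff i| ≤ G' := fun i => by
    have h := abs_coeff_rescaledResidual_le hg hgG
      (show |v⁻¹| ≤ c₀⁻¹ by rw [abs_inv]; exact inv_anti₀ hc₀ hv) i
    rwa [hG', abs_of_nonneg hG0]
  set Z : ℝ := 4 * (q + 1) ^ 3 * G' * κ⁻¹ * 3 ^ s * R ^ s * R ^ (q - 1) with hZ
  -- `Z` carries `R ^ (q - 1)`; the size `3R` of a feature restores the full power `R ^ q` in `D`.
  have hZR : Z * R = Z₀ * D := by
    rw [hZ, hZ₀, hD, ← Nat.sub_add_cancel hq1, pow_succ R (q - 1), Nat.add_sub_cancel]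
    ring
  have hZ0 : 0 ≤ Z := by positivity
  have hZD : Z ≤ Z₀ * D := by rw [← hZR]; exact le_mul_of_one_le_right hZ0 hR1
  obtain ⟨E, hEm, hEp, hE⟩ := exists_event_relu_approx hq1 hs hκ hρ
    (natDegree_rescaledResidual_le hq1 hg v⁻¹) hG'0 hFG P hR1 hm1 hη0 htail hZ
  refine ⟨E, hEm, hEp, fun w hw => ?_⟩
  obtain ⟨c, hc, hcerr⟩ := hE w hw
  refine ⟨c, fun i => ?_, ?_⟩
  · calc |c i| ≤ Z * (m : ℝ)⁻¹ := by rw [← div_eq_mul_inv]; exact hc i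
      _ ≤ (Z₀ * (C₀ * Λ)) * (2 * x) := by
          gcongr
          exact hZD.trans (by gcongr)
      _ = (2 * Z₀ * C₀) * Λ * x := by ring
      _ ≤ _ := by
          gcongr
          have : 0 ≤ B₁ / γ₁ := by positivity
          have : 0 ≤ B₂ / γ₂ ^ 2 := by positivity
          linarith
  · rw [gaussNormSq_eq_lintegral, hexp]
    set T₁ : (Fin d → ℝ) → ℝ := fun y =>
      ∑ i, c i * relu ((w i).1 * MvPolynomial.eval y P + (w i).2) -
        (rescaledResidual g v⁻¹).eval (MvPolynomial.eval y P) with hT₁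
    set T₂ : (Fin d → ℝ) → ℝ := fun y =>
      g.eval (MvPolynomial.eval y (MvPolynomial.C v⁻¹ * P)) - g.eval (MvPolynomial.eval y p)
      with hT₂
    have hT₂m : Measurable T₂ :=
      (g.continuous.measurable.comp (measurable_mvPolynomial_eval _)).sub
        (g.continuous.measurable.comp (measurable_mvPolynomial_eval _))
    -- The `-z` in the rescaled residual cancels the residual link, leaving the approximation error
    -- `T₁` at `phat` and the estimation error `T₂`.
    have hdecomp : ∀ y, residualNet w c (MvPolynomial.eval y P) - g.eval (MvPolynomial.eval y p) =
        T₁ y + T₂ y := by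
      intro y
      simp only [residualNet, hT₁, hT₂, eval_rescaledResidual, map_mul, MvPolynomial.eval_C]
      ring
    have hfinal : 2 * ((Z * (3 * R)) ^ 2 / (m * η) + (3 * Z + (q + 1) * G') ^ 2 * T) +
        2 * (C₁ * (c₀⁻¹ ^ 2 * τ)) ≤
        (2 * Z₀ * C₀ + B₁ / γ₁ + B₂ / γ₂ ^ 2) * (Γ * Λ ^ 2) * x := by
      have h1 : 3 * Z + (q + 1) * G' ≤ H₀ * D := by
        calc 3 * Z + (q + 1) * G' ≤ 3 * (Z₀ * D) + (q + 1) * G' * D := by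
              have : (q + 1) * G' ≤ (q + 1) * G' * D := le_mul_of_one_le_right (by positivity) hD1
              linarith
          _ = H₀ * D := by rw [hH₀]; ring
      have h2 : Z * (3 * R) = 3 * Z₀ * D := by linarith
      have hB₂' : 2 * (C₁ * (c₀⁻¹ ^ 2 * τ)) = B₂ * Γ * x := by rw [hB₂, hτ]; ring
      rw [h2, hB₂']
      exact error_budget_le hm0 hη0 hZ₀0.le hH₀0.le hC₀.le (by linarith) hT0 hx0.le hγ₁0 hγ₂0 hB₂0
        (by positivity) h1 hRD hminv hRtail hΓ1 hΛ1 (by positivity)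
    simp_rw [hdecomp]
    refine (lintegral_ofReal_sq_add_le _ T₁ hT₂m).trans ?_
    calc _ ≤ ENNReal.ofReal 2 * (ENNReal.ofReal ((Z * (3 * R)) ^ 2 / (m * η)) +
          ENNReal.ofReal ((3 * Z + (q + 1) * G') ^ 2) * ENNReal.ofReal T) +
          ENNReal.ofReal 2 * ENNReal.ofReal (C₁ * (c₀⁻¹ ^ 2 * τ)) :=
          add_le_add (mul_le_mul_right hcerr _) (mul_le_mul_right hcompose _)
      _ = ENNReal.ofReal (2 * ((Z * (3 * R)) ^ 2 / (m * η) + (3 * Z + (q + 1) * G') ^ 2 * T) +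
          2 * (C₁ * (c₀⁻¹ ^ 2 * τ))) := by
          have b1 : 0 ≤ (Z * (3 * R)) ^ 2 / (m * η) := by positivity
          have b2 : 0 ≤ (3 * Z + (q + 1) * G') ^ 2 * T := by positivity
          have b3 : 0 ≤ C₁ * (c₀⁻¹ ^ 2 * τ) := by positivity
          rw [← ENNReal.ofReal_mul (sq_nonneg _), ← ENNReal.ofReal_add b1 b2,
            ← ENNReal.ofReal_mul two_pos.le, ← ENNReal.ofReal_mul two_pos.le,
            ← ENNReal.ofReal_add (mul_nonneg two_pos.le (add_nonneg b1 b2))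
              (mul_nonneg two_pos.le b3)]
      _ ≤ _ := ENNReal.ofReal_le_ofReal hfinal
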